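/- Let $K$ be a field complete for a discrete valuation $\mathrm{val}$ (normalized, $\mathrm{val}(\pi)=1$), with ring of integers $K^\circ$. Let $\mathbf r\in\mathbb Q^n$ and let $K\{\mathbf X;\mathbf r\}=\{\sum a_{\mathbf i}\mathbf X^{\mathbf i} : \mathrm{val}(a_{\mathbf i})-\mathbf r\cdot\mathbf i\to+\infty\}$, with Gauss valuation $\mathrm{val}(a\mathbf X^{\mathbf i})=\mathrm{val}(a)-\mathbf r\cdot\mathbf i$ on terms; $K^\circ\{\mathbf X;\mathbf r\}$ is the subring of series whose terms all have nonnegative Gauss valuation. Fix a monomial order $\le_m$; for terms, $t<t'$ means $\mathrm{val}(t)>\mathrm{val}(t')$, or $\mathrm{val}(t)=\mathrm{val}(t')$ and the monomial of $t$ is $<_m$ that of $t'$. The leading term $\mathrm{LT}(f)$ is the largest term of $f$. Let $J$ be an ideal of $K^\circ\{\mathbf X;\mathbf r\}$ such that, with $I=J\cdot K\{\mathbf X;\mathbf r\}$, the quotient $K\{\mathbf X;\mathbf r\}/I$ has finite dimension $\delta$ over $K$. Let $G\subset J$ be a finite reduced Gröbner basis of $I$ (for every nonzero $f\in I$ some $\mathrm{LT}(g)$,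 $g\in G$, divides $\mathrm{LT}(f)$ in $K\{\mathbf X;\mathbf r\}$; no non-leading term of an element of $G$ is divisible by a leading term of $G$), normalized by $0\le \mathrm{val}(\mathrm{LT}(g))<1$ for $g \in G$. Let $\mathrm{prec}\in\mathbb N$ and suppose that the leading monomials of $G$ are given and that each term of the elements of $G$ is given up to an error of Gauss valuation at least $\mathrm{prec}$. Let $B$ be the set of monomials divisible by no $\mathrm{LT}(g)$, and let $\epsilon$ be the number of monomials $X_im\notin B$ with $m\in B$, $1\le i\le n$. Then $B$ is finite and its image is a $K$-basis of $K\{\mathbf X;\mathbf r\}/I$. Let $c_{i,\mu,m}$ ($\mu,m\in B$) be the entries of the matrix $T_i$ of multiplication by $X_i$ in this basis, and put $v_{\mu,m}=\mathrm{val}(X_im)-\mathrm{val}(\mu)$. Consider the following recursive algorithm. It keeps a table of approximations of the $c_{i,\mu,m}$, each with a precision. Initially $c_{i,\mu,m}=O(\pi^{\ell})$, where $\ell$ is the least integer such that the term $\pi^{\ell}\mu$ is not larger than $X_im$ in the term order. The procedure $\mathrm{MulMat\_rec}(i,\mu,m,k)$ does the following. * If $c_{i,\mu,m}$ is known to precision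 $k$, do nothing. * Else, if $X_im\in B$, set $c_{i,\mu,m}$ to $1$ if $\mu=X_im$ and to $0$ otherwise. * Else, if $X_im$ is the leading monomial of some $g\in G$, with leading coefficient $a$, set $c_{i,\mu,m}$ to $-a^{-1}$ times the coefficient of $\mu$ in $g$ (one multiplication), computed from the given approximations and recorded as known to precision $\mathrm{prec}+\lfloor v_{\mu,m}\rfloor$. * Else, write $m=X_jm'$ with $X_im'\notin B$. For every $\mu'\in B$: let $v$ and $w$ be the valuations of $c_{j,\mu,\mu'}$ and $c_{i,\mu',m'}$ read from their currently known digits (an entry whose known digits are all zero has its precision as valuation); call $\mathrm{MulMat\_rec}(j,\mu,\mu',k-w)$, then $\mathrm{MulMat\_rec}(i,\mu',m',k-v)$; compute the product $c_{j,\mu,\mu'}c_{i,\mu',m'}$. Set $c_{i,\mu,m}$ to the sum of these products $+\,O(\pi^k)$. The algorithm calls $\mathrm{MulMat\_rec}(i,\mu,m,\mathrm{prec}+\lfloor v_{\mu,m}\rfloor)$ for all $i$ and all $\mu,m\in B$. The order of these calls, the enumeration of $B$, the choice of $j$ and the representatives modulo $\pi^k$ are arbitrary. **Theorem.** The algorithm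 terminates and computes the multiplication matrices: at the end every $c_{i,\mu,m}$ is correct to precision $\mathrm{prec}+\lfloor v_{\mu,m}\rfloor$. If the table has one column for each monomial $X_im$ (so that the columns of pairs $(i,m)$, $(i',m')$ with $X_im=X_{i'}m'$, which are equal, are stored only once), it performs at most $C\,\epsilon\,\delta^2\,\mathrm{prec}$ multiplications in $K^\circ$; if it has a separate column for each pair $(i,m)$, it also terminates, gives the same result, and performs at most $C\,n\,\epsilon\,\delta^2\,\mathrm{prec}$ multiplications in $K^\circ$. Here $C$ is an absolute constant, and an entry is multiplied through its mantissa $\pi^{-\ell}c_{i,\mu,m}\in K^\circ$, shifts by powers of $\pi$ being free. -/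

import Mathlib

open scoped WithZero

universe w

namespace TateFGLM

noncomputable section

/-! ### Tate algebras -/

/-- Exponents of monomials in `n` variables; `u` stands for `X ^ u`. -/
abbrev Mon (n : ℕ) := Fin n →₀ ℕ

/-- `X_i * m`. -/
def mulVar {n : ℕ} (i : Fin n) (m : Mon n) : Mon n := m + Finsupp.single i 1

/-- `m / X_i` (only used when `X_i` divides `m`). -/
def divVar {n : ℕ} (i : Fin n) (m : Mon n) : Mon n := m - Finsupp.single i 1

/-- The normalized additive valuation of a nonzero `x` (junk value `0` at `x = 0`). -/
def valK {K : Type*} [Field K] [Valued K ℤᵐ⁰] (x : K) : ℤ := -WithZero.log (Valued.v x)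

/-- `x ∈ π ^ k K°`, that is `val x ≥ k`, with `val 0 = ∞`. -/
def ValGE {K : Type*} [Field K] [Valued K ℤᵐ⁰] (k : ℤ) (x : K) : Prop := x = 0 ∨ k ≤ valK x

/-- The Gauss valuation `- r · u` of the monomial `X ^ u`. -/
def monVal {n : ℕ} (r : Fin n → ℚ) (u : Mon n) : ℚ := -∑ i, r i * (u i : ℚ)

/-- The term `a X ^ u` has Gauss valuation at least `N`, with the convention that the zero term has
infinite valuation. -/
def GaussGE {K : Type*} [Field K] [Valued K ℤᵐ⁰] {n : ℕ} (r : Fin n → ℚ) (N : ℚ) (u : Mon n)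
    (a : K) : Prop := a = 0 ∨ N ≤ (valK a : ℚ) + monVal r u

theorem valGE_iff {K : Type*} [Field K] [Valued K ℤᵐ⁰] (k : ℤ) (x : K) :
    ValGE k x ↔ Valued.v x ≤ WithZero.exp (-k) := by
  unfold ValGE valK
  by_cases hx : x = 0
  · simp [hx]
  · have h0 : Valued.v x ≠ 0 := by simpa using hx
    have h1 : Valued.v x = WithZero.exp (WithZero.log (Valued.v x)) := (WithZero.exp_log h0).symm
    rw [h1, WithZero.exp_le_exp, WithZero.log_exp]
    simp only [hx, false_or]
    constructor <;> intro h <;> linarith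

theorem gaussGE_iff {K : Type*} [Field K] [Valued K ℤᵐ⁰] {n : ℕ} (r : Fin n → ℚ) (N : ℚ)
    (u : Mon n) (a : K) : GaussGE r N u a ↔ ValGE ⌈N - monVal r u⌉ a := by
  unfold GaussGE ValGE
  rw [Int.ceil_le, sub_le_iff_le_add]

theorem GaussGE.mono {K : Type*} [Field K] [Valued K ℤᵐ⁰] {n : ℕ} {r : Fin n → ℚ} {N N' : ℚ}
    {u : Mon n} {a : K} (h : GaussGE r N u a) (hN : N' ≤ N) : GaussGE r N' u a :=
  h.imp id fun h => hN.trans h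

theorem GaussGE.add {K : Type*} [Field K] [Valued K ℤᵐ⁰] {n : ℕ} {r : Fin n → ℚ} {N : ℚ}
    {u : Mon n} {a b : K} (ha : GaussGE r N u a) (hb : GaussGE r N u b) :
    GaussGE r N u (a + b) := by
  rw [gaussGE_iff, valGE_iff] at *
  exact Valuation.map_add_le _ ha hb

theorem GaussGE.neg {K : Type*} [Field K] [Valued K ℤᵐ⁰] {n : ℕ} {r : Fin n → ℚ} {N : ℚ}
    {u : Mon n} {a : K} (ha : GaussGE r N u a) : GaussGE r N u (-a) := by
  rw [gaussGE_iff, valGE_iff] at *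
  rwa [Valuation.map_neg]

theorem GaussGE.sum {K : Type*} [Field K] [Valued K ℤᵐ⁰] {n : ℕ} {r : Fin n → ℚ} {N : ℚ}
    {u : Mon n} {ι : Type*} {s : Finset ι} {f : ι → K} (h : ∀ i ∈ s, GaussGE r N u (f i)) :
    GaussGE r N u (∑ i ∈ s, f i) := by
  rw [gaussGE_iff, valGE_iff]
  refine Valuation.map_sum_le _ fun i hi => ?_
  rw [← valGE_iff, ← gaussGE_iff]
  exact h i hi

theorem monVal_add {n : ℕ} (r : Fin n → ℚ) (u w : Mon n) :
    monVal r (u + w) = monVal r u + monVal r w := by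
  simp [monVal, mul_add, Finset.sum_add_distrib]
  ring

theorem GaussGE.mul {K : Type*} [Field K] [Valued K ℤᵐ⁰] {n : ℕ} {r : Fin n → ℚ} {N M : ℚ}
    {u w : Mon n} {a b : K} (ha : GaussGE r N u a) (hb : GaussGE r M w b) :
    GaussGE r (N + M) (u + w) (a * b) := by
  rcases ha with rfl | ha
  · left; simp
  rcases hb with rfl | hb
  · left; simp
  by_cases ha0 : a = 0
  · left; simp [ha0]
  by_cases hb0 : b = 0
  · left; simp [hb0]
  right
  have h : valK (a * b) = valK a + valK b := by
    unfold valK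
    rw [map_mul, WithZero.log_mul (by simpa using ha0) (by simpa using hb0)]
    ring
  rw [h, monVal_add]
  push_cast
  linarith

/-- The Tate condition: `val (a_u) - r · u → +∞` as `|u| → ∞`. -/
def IsTate {K : Type*} [Field K] [Valued K ℤᵐ⁰] {n : ℕ} (r : Fin n → ℚ)
    (f : MvPowerSeries (Fin n) K) : Prop :=
  ∀ N : ℚ, {u : Mon n | ¬ GaussGE r N u (MvPowerSeries.coeff u f)}.Finite

theorem IsTate.exists_bound {K : Type*} [Field K] [Valued K ℤᵐ⁰] {n : ℕ} {r : Fin n → ℚ}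
    {f : MvPowerSeries (Fin n) K} (hf : IsTate r f) :
    ∃ A : ℚ, ∀ u, GaussGE r A u (MvPowerSeries.coeff u f) := by
  obtain ⟨A, hA⟩ := ((hf 0).image
    fun u => (valK (MvPowerSeries.coeff u f) : ℚ) + monVal r u).bddBelow
  refine ⟨min A 0, fun u => ?_⟩
  by_cases h : GaussGE r 0 u (MvPowerSeries.coeff u f)
  · exact h.mono (min_le_right _ _)
  · right
    exact (min_le_left _ _).trans (hA ⟨u, h, rfl⟩)

theorem IsTate.add {K : Type*} [Field K] [Valued K ℤᵐ⁰] {n : ℕ} {r : Fin n → ℚ}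
    {f g : MvPowerSeries (Fin n) K} (hf : IsTate r f) (hg : IsTate r g) : IsTate r (f + g) := by
  intro N
  refine ((hf N).union (hg N)).subset fun u hu => ?_
  by_contra h
  simp only [Set.mem_union, Set.mem_ofPred_eq, not_or, not_not] at h
  exact hu (by rw [map_add]; exact h.1.add h.2)

theorem IsTate.mul {K : Type*} [Field K] [Valued K ℤᵐ⁰] {n : ℕ} {r : Fin n → ℚ}
    {f g : MvPowerSeries (Fin n) K} (hf : IsTate r f) (hg : IsTate r g) : IsTate r (f * g) := by
  intro N
  obtain ⟨A, hA⟩ := hf.exists_bound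
  obtain ⟨B, hB⟩ := hg.exists_bound
  refine (((hf (N - B)).prod (hg (N - A))).image fun p => p.1 + p.2).subset fun u hu => ?_
  by_contra h
  apply hu
  rw [MvPowerSeries.coeff_mul]
  refine GaussGE.sum fun p hp => ?_
  have hpu : p.1 + p.2 = u := by simpa using hp
  by_cases h1 : GaussGE r (N - B) p.1 (MvPowerSeries.coeff p.1 f)
  · have := h1.mul (hB p.2)
    rw [hpu] at this
    exact this.mono (by linarith)
  · by_cases h2 : GaussGE r (N - A) p.2 (MvPowerSeries.coeff p.2 g)
    · have := (hA p.1).mul h2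
      rw [hpu] at this
      exact this.mono (by linarith)
    · exact absurd ⟨p, ⟨h1, h2⟩, hpu⟩ h

theorem isTate_monomial {K : Type*} [Field K] [Valued K ℤᵐ⁰] {n : ℕ} (r : Fin n → ℚ)
    (u : Mon n) (a : K) : IsTate r (MvPowerSeries.monomial u a) := by
  classical
  intro N
  refine (Set.finite_singleton u).subset fun w hw => ?_
  by_contra h
  have hne : w ≠ u := h
  exact hw (Or.inl (by rw [MvPowerSeries.coeff_monomial, if_neg hne]))

/-- The Tate algebra `K{X; r}` with convergence log-radii `r`. -/
def tateAlgebra (K : Type*) [Field K] [Valued K ℤᵐ⁰] {n : ℕ} (r : Fin n → ℚ) :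
    Subalgebra K (MvPowerSeries (Fin n) K) where
  carrier := {f | IsTate r f}
  mul_mem' hf hg := IsTate.mul hf hg
  add_mem' hf hg := IsTate.add hf hg
  algebraMap_mem' a := by
    have h := isTate_monomial r (0 : Mon n) a
    rwa [MvPowerSeries.monomial_zero_eq_C_apply] at h

/-- The monomial `X ^ u` in `K{X; r}`. -/
def tateMon (K : Type*) [Field K] [Valued K ℤᵐ⁰] {n : ℕ} (r : Fin n → ℚ) (u : Mon n) :
    tateAlgebra K r := ⟨MvPowerSeries.monomial u 1, isTate_monomial r u 1⟩

/-- The coefficient of `X ^ u` in `f`. -/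
def tateCoeff {K : Type*} [Field K] [Valued K ℤᵐ⁰] {n : ℕ} {r : Fin n → ℚ}
    (f : tateAlgebra K r) (u : Mon n) : K := MvPowerSeries.coeff u (f : MvPowerSeries (Fin n) K)

theorem gaussGE_one {K : Type*} [Field K] [Valued K ℤᵐ⁰] {n : ℕ} (r : Fin n → ℚ) (u : Mon n) :
    GaussGE r 0 u (MvPowerSeries.coeff u (1 : MvPowerSeries (Fin n) K)) := by
  classical
  rw [MvPowerSeries.coeff_one]
  split_ifs with h
  · right; simp [h, valK, monVal]
  · left; rfl

/-- The integral Tate algebra `K°{X; r}`: the series all of whose terms have nonnegative Gauss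
valuation. -/
def integralTate (K : Type*) [Field K] [Valued K ℤᵐ⁰] {n : ℕ} (r : Fin n → ℚ) :
    Subring (tateAlgebra K r) where
  carrier := {f | ∀ u, GaussGE r 0 u (tateCoeff f u)}
  mul_mem' {f g} hf hg u := by
    change GaussGE r 0 u (MvPowerSeries.coeff u (f.1 * g.1))
    rw [MvPowerSeries.coeff_mul]
    refine GaussGE.sum fun p hp => ?_
    have hpu : p.1 + p.2 = u := by simpa using hp
    have := (hf p.1).mul (hg p.2)
    rw [hpu] at this
    exact this.mono (by simp)
  one_mem' u := gaussGE_one r u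
  add_mem' {f g} hf hg u := by
    change GaussGE r 0 u (MvPowerSeries.coeff u (f.1 + g.1))
    rw [map_add]
    exact (hf u).add (hg u)
  zero_mem' u := Or.inl (by simp [tateCoeff])
  neg_mem' {f} hf u := by
    change GaussGE r 0 u (MvPowerSeries.coeff u (-f.1))
    rw [map_neg]
    exact (hf u).neg

/-! ### Gröbner bases -/

/-- The term order, for nonzero `a` and `b`: `a X ^ u < b X ^ w` if `a X ^ u` has the larger Gauss
valuation, or if the valuations agree and `X ^ u` is smaller for the monomial order. -/
def TermLT {K : Type*} [Field K] [Valued K ℤᵐ⁰] {n : ℕ} (r : Fin n → ℚ)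
    (o : MonomialOrder (Fin n)) (a : K) (u : Mon n) (b : K) (w : Mon n) : Prop :=
  (valK b : ℚ) + monVal r w < (valK a : ℚ) + monVal r u ∨
    ((valK a : ℚ) + monVal r u = (valK b : ℚ) + monVal r w ∧ o.toSyn u < o.toSyn w)

/-- The leading (that is, largest) term of `f` is the one with monomial `X ^ u`. -/
def IsLeadingMon {K : Type*} [Field K] [Valued K ℤᵐ⁰] {n : ℕ} {r : Fin n → ℚ}
    (o : MonomialOrder (Fin n)) (f : tateAlgebra K r) (u : Mon n) : Prop :=
  tateCoeff f u ≠ 0 ∧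
    ∀ w, w ≠ u → tateCoeff f w ≠ 0 → TermLT r o (tateCoeff f w) w (tateCoeff f u) u

/-- `g` is a reduced Gröbner basis of the ideal `I` of `K{X; r}`, and `lm k` is the exponent of the
leading monomial of `g k`. Coefficients being invertible in `K`, divisibility of terms is
divisibility of monomials. -/
structure IsReducedGB {K : Type*} [Field K] [Valued K ℤᵐ⁰] {n : ℕ} {r : Fin n → ℚ}
    (o : MonomialOrder (Fin n)) (I : Ideal (tateAlgebra K r)) {s : ℕ}
    (g : Fin s → tateAlgebra K r) (lm : Fin s → Mon n) : Prop where
  mem : ∀ k, g k ∈ I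
  leading : ∀ k, IsLeadingMon o (g k) (lm k)
  groebner : ∀ f ∈ I, ∀ u, IsLeadingMon o f u → ∃ k, lm k ≤ u
  reduced : ∀ k t, t ≠ lm k → tateCoeff (g k) t ≠ 0 → ∀ l, ¬ lm l ≤ t

/-- The staircase `B`: the monomials not divisible by any leading monomial. -/
def staircase {n s : ℕ} (lm : Fin s → Mon n) : Set (Mon n) := {u | ∀ k, ¬ lm k ≤ u}

/-- The boundary of the staircase: the monomials `X_i m ∉ B` with `m ∈ B`. -/
def boundary {n s : ℕ} (lm : Fin s → Mon n) : Set (Mon n) :=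
  {M | (∃ i, ∃ m ∈ staircase lm, M = mulVar i m) ∧ M ∉ staircase lm}

/-! ### The recursive algorithm -/

/-- Input of the algorithm. Only approximations `coeff k u` of the coefficients of the `k`-th basis
element are given, together with the exponents `lm k` of the leading monomials. -/
structure Input (K : Type*) (n : ℕ) where
  (r : Fin n → ℚ)
  (o : MonomialOrder.{0, w} (Fin n))
  (unif : K)
  (prec : ℕ)
  (s : ℕ)
  (lm : Fin s → Mon n)
  (coeff : Fin s → Mon n → K)

/-- The choices which the algorithm leaves open: an enumeration `stair` of the staircase, the
representative `round k x` used to store `x + O(π ^ k)`, the index `j = factor i m` used to write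
`m = X_j m'`, and the order `calls` in which the entries `(i, μ, m)` are requested. -/
structure Choices (K : Type*) (n : ℕ) where
  (stair : List (Mon n))
  (round : ℤ → K → K)
  (factor : Fin n → Mon n → Fin n)
  (calls : List (Fin n × Mon n × Mon n))

/-- `m = X_j m'` where `X_i m'` is not in the staircase. -/
def IsFactor {n : ℕ} (stair : List (Mon n)) (i : Fin n) (m : Mon n) (j : Fin n) : Prop :=
  0 < m j ∧ mulVar i (divVar j m) ∉ stair

/-- The choices are legitimate for the staircase `B`. -/
structure Choices.Valid {K : Type*} [Field K] [Valued K ℤᵐ⁰] {n : ℕ} (ch : Choices K n)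
    (B : Set (Mon n)) : Prop where
  nodup : ch.stair.Nodup
  mem_stair : ∀ m, m ∈ ch.stair ↔ m ∈ B
  round_spec : ∀ k x, ValGE k (ch.round k x - x)
  factor_spec : ∀ i m, (∃ j, IsFactor ch.stair i m j) → IsFactor ch.stair i m (ch.factor i m)
  mem_calls : ∀ t, t ∈ ch.calls ↔ t.2.1 ∈ B ∧ t.2.2 ∈ B

/-- An element of `K` known up to `O(π ^ prec)`. -/
structure Approx (K : Type*) where
  (val : K)
  (prec : ℤ)

/-- The valuation of an approximation, as read on the known digits: the position of the first
nonzero digit, or the precision if all known digits are zero. -/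
def Approx.knownVal {K : Type*} [Field K] [Valued K ℤᵐ⁰] (a : Approx K) : ℤ :=
  open Classical in if ValGE a.prec a.val then a.prec else valK a.val

/-- The global table, with one approximation for each slot in `S` and each row `μ`, and the log of
the multiplications performed so far (the pairs of operands). -/
structure State (K : Type*) (n : ℕ) (S : Type*) where
  (table : S → Mon n → Approx K)
  (mults : List (K × K))

/-- Overwrites one entry of the table. -/
def State.set {K : Type*} {n : ℕ} {S : Type*} (σ : State K n S) (p : S) (μ : Mon n)
    (a : Approx K) : State K n S :=
  open Classical in
  { σ with table := fun q ν => if q = p ∧ ν = μ then a else σ.table q ν }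

/-- Records a multiplication. -/
def State.log {K : Type*} {n : ℕ} {S : Type*} (σ : State K n S) (x y : K) : State K n S :=
  { σ with mults := (x, y) :: σ.mults }

/-- `v_{μ, m} = val (X_i m) - val (μ)`, where `M = X_i m`. -/
def Input.v {K : Type*} {n : ℕ} (A : Input.{w} K n) (M μ : Mon n) : ℚ :=
  monVal A.r M - monVal A.r μ

/-- The full working precision `prec + ⌊v_{μ, m}⌋` of an entry. -/
def Input.full {K : Type*} {n : ℕ} (A : Input.{w} K n) (M μ : Mon n) : ℤ := A.prec + ⌊A.v M μ⌋

/-- The number of digits of an entry that the term order forces to be zero: the least integer `l`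
such that the term `π ^ l μ` is not larger than `M = X_i m` in the term order. -/
def Input.low {K : Type*} {n : ℕ} (A : Input.{w} K n) (M μ : Mon n) : ℤ :=
  if A.o.toSyn M < A.o.toSyn μ then ⌊A.v M μ⌋ + 1 else ⌈A.v M μ⌉

/-- At the beginning each entry has its forced zero digits, and nothing else is known. -/
def initState {K : Type*} [Field K] {n : ℕ} {S : Type*} (A : Input.{w} K n)
    (mon : S → Mon n) : State K n S :=
  ⟨fun p μ => ⟨0, A.low (mon p) μ⟩, []⟩

/-- `MulMat_rec (G, B, i, μ, m, k)`, with a bound `fuel` on the recursion depth: the value is `none`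
when this bound is exceeded, or when no decomposition `m = X_j m'` exists. Requests for the forced
zero digits only are met by the first test, since the table is initialized with these digits.

The entry `(i, μ, m)` is stored in the row `μ` of the slot `slot i m` of the table. All products are
computed in `K°`: an entry `c` is used as `π ^ l * x` with `l` its number of forced zero digits,
and the operands `x` are logged. -/
def mulMatRec {K : Type*} [Field K] [Valued K ℤᵐ⁰] {n : ℕ} {S : Type*} (A : Input.{w} K n)
    (ch : Choices K n) (slot : Fin n → Mon n → S) :
    ℕ → State K n S → Fin n → Mon n → Mon n → ℤ → Option (State K n S)
  | 0, _, _, _, _, _ => none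
  | fuel + 1, σ, i, μ, m, k =>
    open Classical in
    let M := mulVar i m
    if k ≤ (σ.table (slot i m) μ).prec then
      some σ
    else if M ∈ ch.stair then
      some (σ.set (slot i m) μ ⟨if μ = M then 1 else 0, A.full M μ⟩)
    else
      match (List.finRange A.s).find? (fun g => decide (A.lm g = M)) with
      | some g =>
        -- the coordinate of `μ` in the normal form of `LT g`, divided by the leading coefficient
        let l := A.low M μ
        let e := ⌈-monVal A.r M⌉
        let x := A.unif ^ (-(l + e)) * A.coeff g μ
        let y := A.unif ^ e * (A.coeff g M)⁻¹
        some ((σ.log x y).set (slot i m) μ ⟨-(A.unif ^ l * (x * y)), A.full M μ⟩)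
      | none =>
        let j := ch.factor i m
        let m' := divVar j m
        if IsFactor ch.stair i m j then
          (ch.stair.foldlM (init := (σ, (0 : K))) fun st μ' =>
            let v := (st.1.table (slot j μ') μ).knownVal
            let w := (st.1.table (slot i m') μ').knownVal
            (mulMatRec A ch slot fuel st.1 j μ μ' (k - w)).bind fun σ₁ =>
            (mulMatRec A ch slot fuel σ₁ i μ' m' (k - v)).bind fun σ₂ =>
            let l₁ := A.low (mulVar j μ') μ
            let l₂ := A.low (mulVar i m') μ'
            let x := A.unif ^ (-l₁) * (σ₂.table (slot j μ') μ).val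
            let y := A.unif ^ (-l₂) * (σ₂.table (slot i m') μ').val
            some (σ₂.log x y, st.2 + A.unif ^ (l₁ + l₂) * (x * y))).bind fun res =>
          some (res.1.set (slot i m) μ ⟨ch.round k res.2, k⟩)
        else
          none

/-- The whole algorithm: the entries are requested one after the other, each with its full working
precision, starting from the initial state. -/
def mulMat {K : Type*} [Field K] [Valued K ℤᵐ⁰] {n : ℕ} {S : Type*} (A : Input.{w} K n)
    (ch : Choices K n) (slot : Fin n → Mon n → S) (mon : S → Mon n) (fuel : ℕ) :
    Option (State K n S) :=
  ch.calls.foldlM (init := initState A mon) fun σ t =>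
    mulMatRec A ch slot fuel σ t.1 t.2.1 t.2.2 (A.full (mulVar t.1 t.2.2) t.2.1)

/-- The algorithm terminates, computes the matrices `T i` (with entries `T i μ m`, for `μ` and `m`
in `B`) to full working precision, multiplies only elements of `K°`, and performs at most `N`
multiplications. -/
def ComputesMulMat {K : Type*} [Field K] [Valued K ℤᵐ⁰] {n : ℕ} {S : Type*} (A : Input.{w} K n)
    (ch : Choices K n) (slot : Fin n → Mon n → S) (mon : S → Mon n) (B : Set (Mon n))
    (T : Fin n → B → B → K) (N : ℕ) : Prop :=
  ∃ fuel σ, mulMat A ch slot mon fuel = some σ ∧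
    (∀ (i : Fin n) (μ m : B),
      A.full (mulVar i m) μ ≤ (σ.table (slot i m) μ).prec ∧
      ValGE (A.full (mulVar i m) μ) ((σ.table (slot i m) μ).val - T i μ m)) ∧
    (∀ p ∈ σ.mults, ValGE 0 p.1 ∧ ValGE 0 p.2) ∧
    σ.mults.length ≤ N

end

end TateFGLM

namespace TateFGLM

noncomputable section

/-! ### Valuations -/

section Valuation

variable {K : Type*} [Field K] [Valued K ℤᵐ⁰]

/-! The monomial basis comes from division. Gauss valuations lie in a discrete group, with gap `η`.
Among terms of equal Gauss valuation, well-founded induction on the monomial order shows that one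
division pass sends a series of valuation at least `N` to a remainder supported on the staircase
plus an error of valuation at least `N + η` (`IsReducedGB.reducible`). The normalization of the
leading terms makes the quotients lose at most 1, so by completeness the passes can be iterated to a
limit (`IsReducedGB.division`). Staircase monomials are independent because the leading monomial of
a nonzero combination of them lies in the staircase, hence is divisible by no leading monomial of
the basis.

An entry of a multiplication matrix depends only on the monomial `M = X_i m`: it is the coordinate
of `M` on `μ`. Since `M` minus its normal form lies in `I`, its leading term can only be `M`; this
gives the forced zero digits (`IsReducedGB.valGE_low_coord`).

Termination uses the pair (relative precision `k - v`, monomial `M`), ordered lexicographically and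
coded as an integer rank. The `v` are additive along a factorization, and the valuation subtracted
in a recursive call is at least the number of forced zero digits of the other factor. So the
relative precision never increases, and if it stays the same, the monomial decreases
(`Input.rank_left`, `Input.rank_right`).

The cost is amortized. A loop makes `δ` multiplications of its own and then writes one entry outside
the staircase. Its recursive calls have smaller rank, so they cannot already have brought that entry
to precision `k`: each loop strictly increases the precision of an entry. An entry starts at its
forced zero digits and gains at most `prec` digits, so `δ` times the total precision of the columns
outside the staircase pays for everything (`Spec.mulMatRec_step`, `Spec.computes`). There are `ε`
such columns when equal columns are shared and at most `n ε` otherwise, with `δ` entries each, so `C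
= 1` suffices. -/

theorem v_eq_exp {x : K} (hx : x ≠ 0) : Valued.v x = WithZero.exp (-valK x) := by
  rw [valK, neg_neg, WithZero.exp_log (by simpa using hx)]

theorem valK_mul {a b : K} (ha : a ≠ 0) (hb : b ≠ 0) : valK (a * b) = valK a + valK b := by
  unfold valK
  rw [map_mul, WithZero.log_mul (by simpa using ha) (by simpa using hb)]
  ring

theorem valK_inv (a : K) : valK a⁻¹ = -valK a := by
  unfold valK
  rw [map_inv₀, WithZero.log_inv]

theorem valK_one : valK (1 : K) = 0 := by simp [valK]

theorem ValGE.zero (k : ℤ) : ValGE k (0 : K) := Or.inl rfl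

theorem valGE_valK (x : K) : ValGE (valK x) x := Or.inr le_rfl

theorem ValGE.le_valK {k : ℤ} {x : K} (h : ValGE k x) (hx : x ≠ 0) : k ≤ valK x :=
  h.resolve_left hx

theorem ValGE.mono {k l : ℤ} {x : K} (h : ValGE k x) (hl : l ≤ k) : ValGE l x :=
  h.imp id hl.trans

theorem ValGE.add {k : ℤ} {x y : K} (hx : ValGE k x) (hy : ValGE k y) : ValGE k (x + y) := by
  rw [valGE_iff] at *
  exact Valuation.map_add_le _ hx hy

theorem ValGE.neg {k : ℤ} {x : K} (hx : ValGE k x) : ValGE k (-x) := by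
  rw [valGE_iff] at *
  rwa [Valuation.map_neg]

theorem ValGE.sub {k : ℤ} {x y : K} (hx : ValGE k x) (hy : ValGE k y) : ValGE k (x - y) := by
  rw [sub_eq_add_neg]
  exact hx.add hy.neg

theorem ValGE.mul {k l : ℤ} {x y : K} (hx : ValGE k x) (hy : ValGE l y) :
    ValGE (k + l) (x * y) := by
  by_cases hx0 : x = 0
  · left; simp [hx0]
  by_cases hy0 : y = 0
  · left; simp [hy0]
  right
  rw [valK_mul hx0 hy0]
  exact add_le_add (hx.le_valK hx0) (hy.le_valK hy0)

theorem ValGE.inv_of_le {k : ℤ} {x : K} (h : valK x ≤ k) : ValGE (-k) x⁻¹ := by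
  right
  rw [valK_inv]
  linarith

/-- Adding an element of larger valuation does not change the valuation. -/
theorem valK_eq_of_sub {x y : K} (hx : x ≠ 0) (h : ValGE (valK x + 1) (y - x)) :
    y ≠ 0 ∧ valK y = valK x := by
  have hv : Valued.v y = Valued.v x := by
    refine Valuation.map_eq_of_sub_lt _ ?_
    rw [valGE_iff] at h
    refine h.trans_lt ?_
    rw [v_eq_exp hx, WithZero.exp_lt_exp]
    linarith
  refine ⟨fun h0 => hx ?_, by rw [valK, valK, hv]⟩
  rw [h0, map_zero] at hv
  simpa using hv.symm

theorem eq_zero_of_forall_valGE {x : K} (h : ∀ k : ℤ, ValGE k x) : x = 0 := by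
  rcases h (valK x + 1) with h | h
  · exact h
  · linarith

variable {unif : K}

theorem unif_ne_zero (hu : Valued.v unif = WithZero.exp (-1 : ℤ)) : unif ≠ 0 := by
  rintro rfl
  rw [map_zero] at hu
  exact WithZero.exp_ne_zero hu.symm

theorem v_unif_zpow (hu : Valued.v unif = WithZero.exp (-1 : ℤ)) (k : ℤ) :
    Valued.v (unif ^ k) = WithZero.exp (-k) := by
  rw [map_zpow₀, hu, ← WithZero.exp_zsmul]
  simp

theorem valGE_unif_zpow (hu : Valued.v unif = WithZero.exp (-1 : ℤ)) (k : ℤ) :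
    ValGE k (unif ^ k) := by
  rw [valGE_iff, v_unif_zpow hu]

/-- Convergence in a complete discretely valued field, with an explicit rate. -/
theorem exists_limit [CompleteSpace K] (hu : Valued.v unif = WithZero.exp (-1 : ℤ))
    {x : ℕ → K} {k : ℕ → ℤ} (hmono : Monotone k) (htop : ∀ N, ∃ j, N ≤ k j)
    (h : ∀ j, ValGE (k j) (x (j + 1) - x j)) : ∃ y, ∀ j, ValGE (k j) (y - x j) := by
  have hij : ∀ j i, ValGE (k j) (x (j + i) - x j) := by
    intro j i
    induction i with
    | zero => left; simp
    | succ i ih =>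
      have := ((h (j + i)).mono (hmono (Nat.le_add_right j i))).add ih
      rwa [sub_add_sub_cancel, add_assoc] at this
  have hc : CauchySeq x := by
    refine Valued.cauchy_iff.2 ⟨inferInstance, fun γ => ?_⟩
    have hγ : MonoidWithZeroHom.ValueGroup₀.embedding γ.1 ≠ (0 : ℤᵐ⁰) := by
      simp
    obtain ⟨j, hj⟩ := htop (-WithZero.log (MonoidWithZeroHom.ValueGroup₀.embedding γ.1) + 1)
    refine ⟨x '' Set.Ici j, Filter.image_mem_map (Filter.Ici_mem_atTop j), ?_⟩
    rintro _ ⟨a, ha, rfl⟩ _ ⟨b, hb, rfl⟩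
    obtain ⟨a, rfl⟩ := Nat.exists_eq_add_of_le ha
    obtain ⟨b, rfl⟩ := Nat.exists_eq_add_of_le hb
    have := (hij j b).sub (hij j a)
    rw [sub_sub_sub_cancel_right, valGE_iff] at this
    rw [Valuation.restrict_lt_iff_lt_embedding]
    refine this.trans_lt ?_
    rw [← WithZero.exp_log hγ, WithZero.exp_lt_exp]
    linarith
  obtain ⟨y, hy⟩ := cauchySeq_tendsto_of_complete hc
  refine ⟨y, fun j => ?_⟩
  have hr : Valued.v.restrict (unif ^ k j) ≠ 0 := by
    rw [Ne, Valuation.zero_iff]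
    exact zpow_ne_zero _ (unif_ne_zero hu)
  -- An open ball around the limit, of radius the size of `unif ^ k j`, contains some later term of
  -- the sequence; the ultrametric inequality then transfers its distance from `x j` to the limit.
  have hmem : {z : K | Valued.v.restrict (z - y) < (Units.mk0 _ hr).1} ∈ nhds y :=
    Valued.mem_nhds.2 ⟨_, subset_rfl⟩
  obtain ⟨i, hi, hi'⟩ := ((hy.eventually hmem).and (Filter.eventually_ge_atTop j)).exists
  obtain ⟨i, rfl⟩ := Nat.exists_eq_add_of_le hi'
  have h1 : ValGE (k j) (x (j + i) - y) := by
    rw [valGE_iff, ← v_unif_zpow hu]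
    exact (Valued.v.restrict_lt_iff.1 hi).le
  have := (hij j i).sub h1
  rwa [sub_sub_sub_cancel_left] at this

end Valuation

/-! ### Gauss valuations of series -/

section Tate

variable {K : Type*} [Field K] [Valued K ℤᵐ⁰] {n : ℕ} {r : Fin n → ℚ}

theorem GaussGE.sub {N : ℚ} {u : Mon n} {a b : K} (ha : GaussGE r N u a) (hb : GaussGE r N u b) :
    GaussGE r N u (a - b) := by
  rw [sub_eq_add_neg]
  exact ha.add hb.neg

theorem tateCoeff_add (f g : tateAlgebra K r) (u : Mon n) :
    tateCoeff (f + g) u = tateCoeff f u + tateCoeff g u := rfl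

theorem tateCoeff_sub (f g : tateAlgebra K r) (u : Mon n) :
    tateCoeff (f - g) u = tateCoeff f u - tateCoeff g u := rfl

theorem tateCoeff_zero (u : Mon n) : tateCoeff (0 : tateAlgebra K r) u = 0 := rfl

theorem tateCoeff_smul (a : K) (f : tateAlgebra K r) (u : Mon n) :
    tateCoeff (a • f) u = a * tateCoeff f u := rfl

theorem tateCoeff_sum {ι : Type*} (t : Finset ι) (f : ι → tateAlgebra K r) (u : Mon n) :
    tateCoeff (∑ i ∈ t, f i) u = ∑ i ∈ t, tateCoeff (f i) u := by
  classical
  induction t using Finset.induction_on with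
  | empty => rfl
  | insert i t hi ih => rw [Finset.sum_insert hi, Finset.sum_insert hi, tateCoeff_add, ih]

theorem tateCoeff_ext {f g : tateAlgebra K r} (h : ∀ u, tateCoeff f u = tateCoeff g u) : f = g :=
  Subtype.ext (MvPowerSeries.ext h)

open Classical in
theorem tateCoeff_tateMon (u w : Mon n) :
    tateCoeff (tateMon K r u) w = if w = u then 1 else 0 :=
  MvPowerSeries.coeff_monomial w u 1

open Classical in
theorem tateCoeff_term (a : K) (u w : Mon n) :
    tateCoeff (a • tateMon K r u) w = if w = u then a else 0 := by
  rw [tateCoeff_smul, tateCoeff_tateMon]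
  simp

open Classical in
theorem tateCoeff_sum_terms (t : Finset (Mon n)) (c : Mon n → K) (w : Mon n) :
    tateCoeff (∑ u ∈ t, c u • tateMon K r u) w = if w ∈ t then c w else 0 := by
  simp_rw [tateCoeff_sum, tateCoeff_term]
  simp

theorem tateMon_mul (u w : Mon n) :
    tateMon K r u * tateMon K r w = tateMon K r (u + w) := by
  refine Subtype.ext ?_
  change MvPowerSeries.monomial u 1 * MvPowerSeries.monomial w 1 = MvPowerSeries.monomial _ _
  rw [MvPowerSeries.monomial_mul_monomial, one_mul]

theorem term_mul_term (a b : K) (u w : Mon n) :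
    a • tateMon K r u * b • tateMon K r w = (a * b) • tateMon K r (u + w) := by
  rw [smul_mul_smul_comm, tateMon_mul]

/-- All terms of `f` have Gauss valuation at least `N`. -/
def GaussBdd (N : ℚ) (f : tateAlgebra K r) : Prop := ∀ u, GaussGE r N u (tateCoeff f u)

theorem GaussBdd.mono {N M : ℚ} {f : tateAlgebra K r} (h : GaussBdd N f) (hM : M ≤ N) :
    GaussBdd M f := fun u => (h u).mono hM

theorem GaussBdd.zero (N : ℚ) : GaussBdd N (0 : tateAlgebra K r) := fun _ => Or.inl rfl

theorem GaussBdd.add {N : ℚ} {f g : tateAlgebra K r} (hf : GaussBdd N f) (hg : GaussBdd N g) :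
    GaussBdd N (f + g) := fun u => (hf u).add (hg u)

theorem GaussBdd.sub {N : ℚ} {f g : tateAlgebra K r} (hf : GaussBdd N f) (hg : GaussBdd N g) :
    GaussBdd N (f - g) := fun u => (hf u).sub (hg u)

theorem GaussBdd.sum {N : ℚ} {ι : Type*} {t : Finset ι} {f : ι → tateAlgebra K r}
    (h : ∀ i ∈ t, GaussBdd N (f i)) : GaussBdd N (∑ i ∈ t, f i) := fun u => by
  rw [tateCoeff_sum]
  exact GaussGE.sum fun i hi => h i hi u

theorem GaussBdd.mul {N M : ℚ} {f g : tateAlgebra K r} (hf : GaussBdd N f) (hg : GaussBdd M g) :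
    GaussBdd (N + M) (f * g) := fun u => by
  change GaussGE r _ u (MvPowerSeries.coeff u (f.1 * g.1))
  rw [MvPowerSeries.coeff_mul]
  refine GaussGE.sum fun p hp => ?_
  have hpu : p.1 + p.2 = u := by simpa using hp
  have := (hf p.1).mul (hg p.2)
  rwa [hpu] at this

theorem GaussGE.term {N : ℚ} {a : K} {u : Mon n} (h : GaussGE r N u a) :
    GaussBdd N (a • tateMon K r u) := fun w => by
  rw [tateCoeff_term]
  split_ifs with hw
  · rwa [hw]
  · exact Or.inl rfl

theorem eq_zero_of_forall_gaussGE {u : Mon n} {a : K} (h : ∀ N, GaussGE r N u a) : a = 0 :=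
  eq_zero_of_forall_valGE fun k => by
    have := h (k + monVal r u)
    rwa [gaussGE_iff, add_sub_cancel_right, Int.ceil_intCast] at this

/-- The Tate algebra is complete for the Gauss valuation. -/
theorem exists_tate_limit [CompleteSpace K] {unif : K}
    (hu : Valued.v unif = WithZero.exp (-1 : ℤ)) {c η : ℚ} (hη : 0 < η)
    {f : ℕ → tateAlgebra K r} (h : ∀ j : ℕ, GaussBdd (c + j * η) (f (j + 1) - f j)) :
    ∃ F : tateAlgebra K r, ∀ j : ℕ, GaussBdd (c + j * η) (F - f j) := by
  have key : ∀ u : Mon n, ∃ y : K, ∀ j : ℕ,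
      ValGE ⌈c + j * η - monVal r u⌉ (y - tateCoeff (f j) u) := by
    intro u
    refine exists_limit hu (x := fun j => tateCoeff (f j) u) ?_ ?_ ?_
    · intro i j hij
      have : (i : ℚ) ≤ j := by exact_mod_cast hij
      exact Int.ceil_mono (by gcongr)
    · intro N
      obtain ⟨j, hj⟩ := exists_nat_ge ((N - c + monVal r u) / η)
      refine ⟨j, ?_⟩
      rw [div_le_iff₀ hη] at hj
      have := Int.le_ceil (c + j * η - monVal r u)
      exact_mod_cast (by linarith : (N : ℚ) ≤ ⌈c + j * η - monVal r u⌉)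
    · intro j
      have := h j u
      rwa [gaussGE_iff] at this
  choose F hF using key
  have hF' : ∀ (j : ℕ) (u : Mon n), GaussGE r (c + j * η) u (F u - tateCoeff (f j) u) := by
    intro j u
    rw [gaussGE_iff]
    exact hF u j
  -- For `j` large the limit agrees with `f j` up to valuation `N`, so only the finitely many
  -- exceptional exponents of `f j` matter.
  have htate : IsTate r (F : MvPowerSeries (Fin n) K) := by
    intro N
    obtain ⟨j, hj⟩ := exists_nat_ge ((N - c) / η)
    rw [div_le_iff₀ hη] at hj
    refine ((f j).2 N).subset fun u hu' => ?_
    intro h'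
    refine hu' ?_
    have := ((hF' j u).mono (by linarith : N ≤ c + j * η)).add h'
    change GaussGE r N u (F u - tateCoeff (f j) u + tateCoeff (f j) u) at this
    rwa [sub_add_cancel] at this
  exact ⟨⟨F, htate⟩, hF'⟩

/-- Clearing the denominators of `r` makes Gauss valuations integral. This gives both the gap `η`
and the integer rank used for termination. -/
theorem monVal_den_mul (u : Mon n) :
    ∃ z : ℤ, ((∏ i, (r i).den : ℕ) : ℚ) * monVal r u = z := by
  refine ⟨-∑ i, (∏ j ∈ Finset.univ.erase i, (r j).den : ℕ) * (r i).num * u i, ?_⟩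
  simp only [monVal]
  push_cast
  rw [mul_neg, Finset.mul_sum]
  congr 1
  refine Finset.sum_congr rfl fun i _ => ?_
  rw [← Finset.mul_prod_erase _ _ (Finset.mem_univ i), ← mul_assoc]
  congr 1
  rw [mul_comm ((r i).den : ℚ), mul_assoc, mul_comm ((r i).den : ℚ), Rat.mul_den_eq_num]

theorem prod_den_pos (r : Fin n → ℚ) : 0 < ∏ i, (r i).den := Finset.prod_pos fun i _ => (r i).pos

/-- The value group of the Gauss valuation is discrete. -/
theorem gauss_discrete (r : Fin n → ℚ) : ∃ η : ℚ, 0 < η ∧ ∀ (x y : ℤ) (u w : Mon n),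
    (x : ℚ) + monVal r u < y + monVal r w → (x : ℚ) + monVal r u + η ≤ y + monVal r w := by
  set D : ℚ := ((∏ i, (r i).den : ℕ) : ℚ) with hD
  have hD0 : 0 < D := Nat.cast_pos.2 (prod_den_pos r)
  refine ⟨D⁻¹, inv_pos.2 hD0, fun x y u w h => ?_⟩
  obtain ⟨a, ha⟩ := monVal_den_mul (r := r) u
  obtain ⟨b, hb⟩ := monVal_den_mul (r := r) w
  rw [← hD] at ha hb
  set d : ℤ := ((∏ i, (r i).den : ℕ) : ℤ) with hd
  have hdD : (d : ℚ) = D := by simp [hd, hD]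
  rw [← mul_lt_mul_iff_right₀ hD0, mul_add, mul_add, ha, hb, ← hdD] at h
  have h2 : d * x + a + 1 ≤ d * y + b := by
    have : d * x + a < d * y + b := by exact_mod_cast h
    linarith
  have h3 : (d : ℚ) * x + a + 1 ≤ d * y + b := by exact_mod_cast h2
  rw [← mul_le_mul_iff_right₀ hD0, mul_add, mul_add, mul_add, ha, hb, mul_inv_cancel₀ hD0.ne',
    ← hdD]
  exact h3

end Tate

/-! ### Division and the monomial basis of the quotient -/

section Groebner

variable {K : Type*} [Field K] [Valued K ℤᵐ⁰] {n : ℕ} {r : Fin n → ℚ}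
  {o : MonomialOrder (Fin n)} {I : Ideal (tateAlgebra K r)} {s : ℕ}
  {g : Fin s → tateAlgebra K r} {lm : Fin s → Mon n}

/-- A nonzero polynomial has a leading monomial. -/
theorem exists_isLeadingMon (o : MonomialOrder (Fin n)) {f : tateAlgebra K r} {t : Finset (Mon n)}
    (ht : ∀ u, tateCoeff f u ≠ 0 → u ∈ t) (hf : f ≠ 0) : ∃ u ∈ t, IsLeadingMon o f u := by
  classical
  have hne : (t.filter fun u => tateCoeff f u ≠ 0).Nonempty := by
    by_contra h
    rw [Finset.not_nonempty_iff_eq_empty, Finset.filter_eq_empty_iff] at h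
    refine hf (tateCoeff_ext fun u => ?_)
    rw [tateCoeff_zero]
    by_contra hu
    exact h (ht u hu) hu
  -- The term order is the lexicographic order on (minus the Gauss valuation, monomial), so the
  -- leading term is a maximum over a finite support.
  obtain ⟨u, hu, hmax⟩ := Finset.exists_max_image _
    (fun u => (toLex (-((valK (tateCoeff f u) : ℚ) + monVal r u), o.toSyn u) : ℚ ×ₗ o.syn)) hne
  rw [Finset.mem_filter] at hu
  refine ⟨u, hu.1, hu.2, fun w hw hw0 => ?_⟩
  have := hmax w (Finset.mem_filter.2 ⟨ht w hw0, hw0⟩)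
  rw [Prod.Lex.toLex_le_toLex] at this
  rcases this with h | ⟨h1, h2⟩
  · left
    simp only at h
    linarith
  · right
    simp only at h1 h2
    exact ⟨by linarith, lt_of_le_of_ne h2 fun h => hw (o.toSyn.injective h)⟩

/-- The leading monomial would lie in the staircase and also be divisible by some `lm k`. -/
theorem IsReducedGB.not_mem_of_staircase (hG : IsReducedGB o I g lm) {f : tateAlgebra K r}
    {t : Finset (Mon n)} (ht : ∀ u ∈ t, u ∈ staircase lm) (hsupp : ∀ u, tateCoeff f u ≠ 0 → u ∈ t)
    (hf : f ≠ 0) : f ∉ I := by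
  intro hI
  obtain ⟨u, hu, hlead⟩ := exists_isLeadingMon o hsupp hf
  obtain ⟨k, hk⟩ := hG.groebner f hI u hlead
  exact ht u hu k hk

/-- The image of a monomial in the quotient. -/
def quotMon (I : Ideal (tateAlgebra K r)) (u : Mon n) : tateAlgebra K r ⧸ I :=
  Ideal.Quotient.mk I (tateMon K r u)

theorem mk_smul (a : K) (f : tateAlgebra K r) :
    Ideal.Quotient.mk I (a • f) = a • Ideal.Quotient.mk I f := rfl

theorem quotMon_mul (u w : Mon n) : quotMon I u * quotMon I w = quotMon I (u + w) := by
  rw [quotMon, quotMon, ← map_mul, tateMon_mul, quotMon]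

theorem IsReducedGB.linearIndependent (hG : IsReducedGB o I g lm) :
    LinearIndependent K fun m : staircase lm => quotMon I m.1 := by
  classical
  rw [linearIndependent_iff']
  intro t c hc m hm
  by_contra hne
  set c' : Mon n → K := fun u => if h : u ∈ staircase lm then c ⟨u, h⟩ else 0 with hc'
  set f : tateAlgebra K r := ∑ u ∈ t.image Subtype.val, c' u • tateMon K r u with hf
  have hcoef : ∀ w, tateCoeff f w = if w ∈ t.image Subtype.val then c' w else 0 :=
    fun w => tateCoeff_sum_terms _ _ _
  refine hG.not_mem_of_staircase (f := f) (t := t.image Subtype.val) ?_ ?_ ?_ ?_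
  · intro u hu
    obtain ⟨x, -, rfl⟩ := Finset.mem_image.1 hu
    exact x.2
  · intro u hu
    by_contra h
    rw [hcoef, if_neg h] at hu
    exact hu rfl
  · intro h0
    have := hcoef m.1
    rw [h0, tateCoeff_zero, if_pos (Finset.mem_image_of_mem _ hm)] at this
    simp only [hc', dif_pos m.2] at this
    exact hne this.symm
  · rw [← Ideal.Quotient.eq_zero_iff_mem, hf, map_sum, Finset.sum_image (fun a _ b _ h =>
      Subtype.ext h), ← hc]
    refine Finset.sum_congr rfl fun x _ => ?_
    rw [mk_smul]
    simp only [hc', dif_pos x.2]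
    rfl

theorem IsReducedGB.staircase_finite (hG : IsReducedGB o I g lm)
    [Module.Finite K (tateAlgebra K r ⧸ I)] : (staircase lm).Finite := by
  have := hG.linearIndependent.lt_aleph0_of_finiteDimensional
  exact Cardinal.lt_aleph0_iff_set_finite.1 this

theorem IsReducedGB.lead_notMem (_ : IsReducedGB o I g lm) (l : Fin s) : lm l ∉ staircase lm :=
  fun h => h l le_rfl

theorem IsReducedGB.coeff_eq_zero (hG : IsReducedGB o I g lm) {l : Fin s} {t : Mon n}
    (h1 : t ≠ lm l) (h2 : t ∉ staircase lm) : tateCoeff (g l) t = 0 := by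
  by_contra h
  exact h2 (hG.reduced l t h1 h)

/-- Elements of a reduced Gröbner basis with finite staircase are polynomials. -/
theorem IsReducedGB.expand (hG : IsReducedGB o I g lm) (hB : (staircase lm).Finite) (l : Fin s) :
    g l = tateCoeff (g l) (lm l) • tateMon K r (lm l) +
      ∑ t ∈ hB.toFinset, tateCoeff (g l) t • tateMon K r t := by
  classical
  refine tateCoeff_ext fun u => ?_
  rw [tateCoeff_add, tateCoeff_term, tateCoeff_sum_terms]
  by_cases hu : u = lm l
  · subst hu
    have := hG.lead_notMem l
    simp [this]
  · by_cases hu2 : u ∈ staircase lm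
    · simp [hu, hu2]
    · simp [hu, hu2, hG.coeff_eq_zero hu hu2]

/-- `f` can be divided by `g` with remainder supported on the staircase, up to an error of Gauss
valuation at least `N + η`. -/
def Reducible (g : Fin s → tateAlgebra K r) (lm : Fin s → Mon n) (η N : ℚ)
    (f : tateAlgebra K r) : Prop :=
  ∃ (q : Fin s → tateAlgebra K r) (ρ : tateAlgebra K r), (∀ l, GaussBdd (N - 1) (q l)) ∧
    GaussBdd N ρ ∧ (∀ t ∉ staircase lm, tateCoeff ρ t = 0) ∧
    GaussBdd (N + η) (f - ∑ l, q l * g l - ρ)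

theorem Reducible.of_bdd {η N : ℚ} {f : tateAlgebra K r} (h : GaussBdd (N + η) f) :
    Reducible g lm η N f :=
  ⟨0, 0, fun _ => GaussBdd.zero _, GaussBdd.zero _, fun _ _ => rfl, by simpa using h⟩

theorem Reducible.add {η N : ℚ} {f f' : tateAlgebra K r} (h : Reducible g lm η N f)
    (h' : Reducible g lm η N f') : Reducible g lm η N (f + f') := by
  obtain ⟨q, ρ, h1, h2, h3, h4⟩ := h
  obtain ⟨q', ρ', h1', h2', h3', h4'⟩ := h'
  refine ⟨q + q', ρ + ρ', fun l => (h1 l).add (h1' l), h2.add h2', fun t ht => ?_, ?_⟩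
  · rw [tateCoeff_add, h3 t ht, h3' t ht, add_zero]
  · convert h4.add h4' using 1
    simp only [Pi.add_apply, add_mul, Finset.sum_add_distrib]
    ring

theorem Reducible.sum {η N : ℚ} {ι : Type*} {t : Finset ι} {f : ι → tateAlgebra K r}
    (h : ∀ i ∈ t, Reducible g lm η N (f i)) : Reducible g lm η N (∑ i ∈ t, f i) := by
  classical
  induction t using Finset.induction_on with
  | empty => exact Reducible.of_bdd (GaussBdd.zero _)
  | insert i t hi ih =>
    rw [Finset.sum_insert hi]
    exact (h i (Finset.mem_insert_self i t)).add
      (ih fun j hj => h j (Finset.mem_insert_of_mem hj))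

theorem Reducible.of_mul {η N : ℚ} {q : tateAlgebra K r} (l : Fin s) (h : GaussBdd (N - 1) q) :
    Reducible g lm η N (q * g l) := by
  classical
  refine ⟨Pi.single l q, 0, fun k => ?_, GaussBdd.zero _, fun _ _ => rfl, ?_⟩
  · by_cases hk : k = l
    · subst hk; simpa using h
    · rw [Pi.single_eq_of_ne hk]; exact GaussBdd.zero _
  · rw [Finset.sum_eq_single l]
    · simpa using GaussBdd.zero _
    · intro k _ hk
      rw [Pi.single_eq_of_ne hk, zero_mul]
    · simp

theorem Reducible.of_staircase {η N : ℚ} {a : K} {u : Mon n} (hu : u ∈ staircase lm)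
    (h : GaussGE r N u a) : Reducible g lm η N (a • tateMon K r u) := by
  classical
  refine ⟨0, a • tateMon K r u, fun _ => GaussBdd.zero _, h.term, fun t ht => ?_, ?_⟩
  · rw [tateCoeff_term, if_neg]
    rintro rfl
    exact ht hu
  · simpa using GaussBdd.zero _

variable (hG : IsReducedGB o I g lm) (hB : (staircase lm).Finite)
  (hnorm : ∀ k, (valK (tateCoeff (g k) (lm k)) : ℚ) + monVal r (lm k) < 1)
  {η : ℚ} (hη : ∀ (x y : ℤ) (u w : Mon n),
    (x : ℚ) + monVal r u < y + monVal r w → (x : ℚ) + monVal r u + η ≤ y + monVal r w)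

include hG hB hnorm hη in
-- If `lm l` divides `u`, a multiple of `g l` cancels the term. Each new term either has strictly
-- larger Gauss valuation, hence by `hη` is part of the error, or has the same bound and a smaller
-- monomial, where the induction applies. Since the leading term of `g l` has valuation below 1, the
-- quotient keeps the bound `N - 1`.
theorem IsReducedGB.reducible_term {N : ℚ} (u : Mon n) :
    ∀ a : K, GaussGE r N u a → Reducible g lm η N (a • tateMon K r u) := by
  refine (InvImage.wf o.toSyn o.wellFoundedLT_syn.wf).induction
    (C := fun u => ∀ a : K, GaussGE r N u a → Reducible g lm η N (a • tateMon K r u)) u ?_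
  intro u ih a ha
  by_cases hu : u ∈ staircase lm
  · exact Reducible.of_staircase hu ha
  by_cases ha0 : a = 0
  · subst ha0
    rw [zero_smul]
    exact Reducible.of_bdd (GaussBdd.zero _)
  simp only [staircase, Set.mem_ofPred_eq, not_forall, not_not] at hu
  obtain ⟨l, hl⟩ := hu
  obtain ⟨u', rfl⟩ := exists_add_of_le hl
  have hlc : tateCoeff (g l) (lm l) ≠ 0 := (hG.leading l).1
  set b := tateCoeff (g l) (lm l) with hb
  have hval := ha.resolve_left ha0
  have hab : valK (a * b⁻¹) = valK a - valK b := by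
    rw [valK_mul ha0 (inv_ne_zero hlc), valK_inv]
    ring
  have hnl := hnorm l
  rw [← hb] at hnl
  rw [monVal_add] at hval
  have hq : GaussBdd (N - 1) ((a * b⁻¹) • tateMon K r u') := by
    refine GaussGE.term (Or.inr ?_)
    rw [hab]
    push_cast
    linarith
  have heq : a • tateMon K r (lm l + u') = (a * b⁻¹) • tateMon K r u' * g l +
      ∑ t ∈ hB.toFinset, (-(a * b⁻¹ * tateCoeff (g l) t)) • tateMon K r (u' + t) := by
    have hexp := congrArg (fun z => (a * b⁻¹) • tateMon K r u' * z) (hG.expand hB l)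
    rw [hexp, mul_add, Finset.mul_sum, term_mul_term, ← hb, inv_mul_cancel_right₀ hlc, add_assoc,
      ← Finset.sum_add_distrib, add_comm u', left_eq_add]
    refine Finset.sum_eq_zero fun t _ => ?_
    rw [term_mul_term, neg_smul, add_neg_cancel]
  rw [heq]
  refine (Reducible.of_mul l hq).add (Reducible.sum fun t ht => ?_)
  rw [Set.Finite.mem_toFinset] at ht
  by_cases ht0 : tateCoeff (g l) t = 0
  · rw [ht0, mul_zero, neg_zero, zero_smul]
    exact Reducible.of_bdd (GaussBdd.zero _)
  have hv : valK (-(a * b⁻¹ * tateCoeff (g l) t)) = valK a - valK b + valK (tateCoeff (g l) t) := by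
    rw [← neg_one_mul, valK_mul (by simp) (by simp [ha0, hlc, ht0]),
      valK_mul (by simp [ha0, hlc]) ht0, hab]
    simp [valK]
  have htl : t ≠ lm l := by
    rintro rfl
    exact hG.lead_notMem l ht
  rcases (hG.leading l).2 t htl ht0 with hlt | ⟨heqv, hlt⟩
  · refine Reducible.of_bdd (GaussGE.term (Or.inr ?_))
    have := hη _ _ _ _ hlt
    rw [hv, monVal_add]
    push_cast
    linarith
  · refine ih (u' + t) ?_ _ (Or.inr ?_)
    · change o.toSyn (u' + t) < o.toSyn (lm l + u')
      rw [map_add, map_add, add_comm]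
      exact add_lt_add_left hlt _
    · rw [hv, monVal_add]
      push_cast
      linarith

include hG hB hnorm hη in
-- Only finitely many terms violate the bound `N + η`; they are reduced one by one, and the tail
-- goes into the error.
theorem IsReducedGB.reducible {N : ℚ} {f : tateAlgebra K r} (hf : GaussBdd N f) :
    Reducible g lm η N f := by
  classical
  set t := (f.2 (N + η)).toFinset with ht
  have hsplit : f = ∑ u ∈ t, tateCoeff f u • tateMon K r u +
      (f - ∑ u ∈ t, tateCoeff f u • tateMon K r u) := by ring
  rw [hsplit]
  refine (Reducible.sum fun u _ => hG.reducible_term hB hnorm hη u _ (hf u)).add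
    (Reducible.of_bdd fun u => ?_)
  rw [tateCoeff_sub, tateCoeff_sum_terms]
  split_ifs with h
  · left; simp
  · rw [sub_zero]
    by_contra h'
    exact h (by rw [ht, Set.Finite.mem_toFinset]; exact h')

include hG hB hnorm in
/-- Division by a reduced Gröbner basis with finite staircase. -/
theorem IsReducedGB.division [CompleteSpace K] {unif : K}
    (hu : Valued.v unif = WithZero.exp (-1 : ℤ)) (f : tateAlgebra K r) :
    ∃ (q : Fin s → tateAlgebra K r) (ρ : tateAlgebra K r),
      (∀ t ∉ staircase lm, tateCoeff ρ t = 0) ∧ f = ∑ l, q l * g l + ρ := by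
  obtain ⟨η, hη0, hη⟩ := gauss_discrete r
  obtain ⟨N, hN⟩ := IsTate.exists_bound f.2
  -- The bound on `f` is a premise inside the existential, so that the chosen quotients and
  -- remainders are total functions and can be iterated.
  have hstep : ∀ (M : ℚ) (f : tateAlgebra K r), ∃ (q : Fin s → tateAlgebra K r)
      (ρ : tateAlgebra K r), GaussBdd M f → (∀ l, GaussBdd (M - 1) (q l)) ∧ GaussBdd M ρ ∧
      (∀ t ∉ staircase lm, tateCoeff ρ t = 0) ∧ GaussBdd (M + η) (f - ∑ l, q l * g l - ρ) := by
    intro M f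
    by_cases hf : GaussBdd M f
    · obtain ⟨q, ρ, h⟩ := hG.reducible hB hnorm hη hf
      exact ⟨q, ρ, fun _ => h⟩
    · exact ⟨0, 0, fun h => absurd h hf⟩
  choose q ρ hqρ using hstep
  set F : ℕ → tateAlgebra K r := fun j => Nat.rec f (fun j f' =>
    f' - ∑ l, q (N + j * η) f' l * g l - ρ (N + j * η) f') j with hF
  have hF1 : ∀ j, F (j + 1) = F j - ∑ l, q (N + j * η) (F j) l * g l - ρ (N + j * η) (F j) :=
    fun j => rfl
  have hFb : ∀ j : ℕ, GaussBdd (N + j * η) (F j) := by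
    intro j
    induction j with
    | zero =>
      rw [Nat.cast_zero, zero_mul, add_zero]
      exact hN
    | succ j ih =>
      rw [hF1]
      convert (hqρ _ _ ih).2.2.2 using 1
      push_cast
      ring
  set Q : ℕ → Fin s → tateAlgebra K r := fun j l => ∑ i ∈ Finset.range j, q (N + i * η) (F i) l
    with hQ
  set R : ℕ → tateAlgebra K r := fun j => ∑ i ∈ Finset.range j, ρ (N + i * η) (F i) with hR
  have hsum : ∀ j, f = ∑ l, Q j l * g l + R j + F j := by
    intro j
    induction j with
    | zero => simp [hQ, hR, hF]
    | succ j ih =>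
      rw [hF1]
      simp only [hQ, hR, Finset.sum_range_succ, add_mul, Finset.sum_add_distrib]
      simp only [hQ, hR] at ih
      rw [add_assoc] at ih
      conv_lhs => rw [ih]
      ring
  have hlimQ : ∀ l, ∃ q' : tateAlgebra K r, ∀ j : ℕ, GaussBdd (N - 1 + j * η) (q' - Q j l) := by
    intro l
    refine exists_tate_limit hu hη0 fun j => ?_
    simp only [hQ, Finset.sum_range_succ, add_sub_cancel_left]
    convert (hqρ _ _ (hFb j)).1 l using 1
    ring
  choose q' hq' using hlimQ
  obtain ⟨ρ', hρ'⟩ : ∃ ρ' : tateAlgebra K r, ∀ j : ℕ, GaussBdd (N + j * η) (ρ' - R j) := by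
    refine exists_tate_limit hu hη0 fun j => ?_
    simp only [hR, Finset.sum_range_succ, add_sub_cancel_left]
    exact (hqρ _ _ (hFb j)).2.1
  have hR0 : ∀ j, ∀ t ∉ staircase lm, tateCoeff (R j) t = 0 := by
    intro j t ht
    simp only [hR]
    rw [tateCoeff_sum]
    exact Finset.sum_eq_zero fun i _ => (hqρ _ _ (hFb i)).2.2.1 t ht
  have hlarge : ∀ c M : ℚ, ∃ j : ℕ, M ≤ c + j * η := by
    intro c M
    obtain ⟨j, hj⟩ := exists_nat_ge ((M - c) / η)
    rw [div_le_iff₀ hη0] at hj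
    exact ⟨j, by linarith⟩
  refine ⟨q', ρ', fun t ht => ?_, ?_⟩
  · refine eq_zero_of_forall_gaussGE (r := r) (u := t) fun M => ?_
    obtain ⟨j, hj⟩ := hlarge N M
    have := hρ' j t
    rw [tateCoeff_sub, hR0 j t ht, sub_zero] at this
    exact this.mono hj
  · choose A hA using fun l => IsTate.exists_bound (g l).2
    obtain ⟨A', hA'⟩ := (Set.finite_range A).bddBelow
    rw [← sub_eq_zero]
    refine tateCoeff_ext fun t => eq_zero_of_forall_gaussGE (r := r) (u := t) fun M => ?_
    -- The difference of the two sides does not depend on `j`. The worst of the three error bounds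
    -- is that of the quotients times the `g l`, namely `N - 1` plus a common lower bound for the `g
    -- l`; the minimum with 0 makes it dominate the other two.
    obtain ⟨j, hj⟩ := hlarge (N - 1 + min A' 0) M
    have h1 : f - (∑ l, q' l * g l + ρ') = F j - ∑ l, (q' l - Q j l) * g l - (ρ' - R j) := by
      conv_lhs => rw [hsum j]
      simp only [sub_mul, Finset.sum_sub_distrib]
      ring
    rw [h1]
    have hmin : min A' 0 ≤ 0 := min_le_right _ _
    refine GaussBdd.sub (GaussBdd.sub ?_ (GaussBdd.sum fun l _ => ?_)) ?_ t
    · exact (hFb j).mono (by linarith)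
    · refine ((hq' l j).mul (M := min A' 0) fun u => ?_).mono (by linarith)
      exact (hA l u).mono ((min_le_left _ _).trans (hA' ⟨l, rfl⟩))
    · exact (hρ' j).mono (by linarith)

include hG hB hnorm in
theorem IsReducedGB.span_eq_top [CompleteSpace K] {unif : K}
    (hu : Valued.v unif = WithZero.exp (-1 : ℤ)) :
    ⊤ ≤ Submodule.span K (Set.range fun m : staircase lm => quotMon I m.1) := by
  classical
  rintro x -
  obtain ⟨f, rfl⟩ := Ideal.Quotient.mk_surjective x
  obtain ⟨q, ρ, hρ, rfl⟩ := hG.division hB hnorm hu f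
  have h1 : ∑ l, q l * g l ∈ I := I.sum_mem fun l _ => I.mul_mem_left _ (hG.mem l)
  have h2 : ρ = ∑ u ∈ hB.toFinset, tateCoeff ρ u • tateMon K r u := by
    refine tateCoeff_ext fun u => ?_
    rw [tateCoeff_sum_terms]
    split_ifs with h
    · rfl
    · exact hρ u (by simpa using h)
  rw [map_add, Ideal.Quotient.eq_zero_iff_mem.2 h1, zero_add, h2, map_sum]
  refine Submodule.sum_mem _ fun u hu' => ?_
  rw [mk_smul]
  exact Submodule.smul_mem _ _ (Submodule.subset_span ⟨⟨u, by simpa using hu'⟩, rfl⟩)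

end Groebner

/-! ### Coordinates in the monomial basis -/

section Monomials

variable {n s : ℕ} {lm : Fin s → Mon n}

theorem staircase_mono {u w : Mon n} (h : u ≤ w) (hw : w ∈ staircase lm) : u ∈ staircase lm :=
  fun k hk => hw k (hk.trans h)

theorem divVar_le (j : Fin n) (m : Mon n) : divVar j m ≤ m := tsub_le_self

theorem mulVar_mulVar_divVar {i j : Fin n} {m : Mon n} (h : 0 < m j) :
    mulVar j (mulVar i (divVar j m)) = mulVar i m := by
  have h1 : Finsupp.single j 1 ≤ m := by
    rw [Finsupp.single_le_iff]
    exact h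
  simp only [mulVar, divVar]
  rw [add_right_comm, tsub_add_cancel_of_le h1]

/-- Some `lm l` divides `X_i m` properly, so a variable `X_j` can be removed from `X_i m` while
keeping divisibility. It is not `X_i`, since otherwise `lm l` would divide `m`; hence it divides
`m`. -/
theorem exists_factor {i : Fin n} {m : Mon n} (hm : m ∈ staircase lm)
    (hM : mulVar i m ∉ staircase lm) (hlm : ∀ l, lm l ≠ mulVar i m) :
    ∃ j, 0 < m j ∧ mulVar i (divVar j m) ∉ staircase lm := by
  simp only [staircase, Set.mem_ofPred_eq, not_forall, not_not] at hM
  obtain ⟨l, hl⟩ := hM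
  have hval : ∀ t, mulVar i m t = m t + if i = t then 1 else 0 := fun t => by
    simp [mulVar, Finsupp.single_apply]
  rw [Finsupp.le_def] at hl
  obtain ⟨j, hj⟩ : ∃ j, lm l j ≠ mulVar i m j := by
    by_contra h
    push Not at h
    exact hlm l (Finsupp.ext h)
  have hj' := lt_of_le_of_ne (hl j) hj
  rw [hval] at hj'
  have hij : i ≠ j := by
    rintro rfl
    refine hm l (Finsupp.le_def.2 fun t => ?_)
    have := hl t
    rw [hval] at this
    rw [if_pos rfl] at hj'
    split_ifs at this with h1
    · subst h1; omega
    · omega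
  rw [if_neg hij] at hj'
  refine ⟨j, by omega, fun hmem => hmem l (Finsupp.le_def.2 fun t => ?_)⟩
  have h1 : mulVar i (divVar j m) t = m t - (if j = t then 1 else 0) + if i = t then 1 else 0 := by
    simp [mulVar, divVar, Finsupp.single_apply]
  have h2 := hl t
  rw [hval] at h2
  rw [h1]
  by_cases hjt : j = t
  · subst hjt
    rw [if_pos rfl, if_neg hij]
    omega
  · rw [if_neg hjt, Nat.sub_zero]
    exact h2

theorem monVal_mulVar_sub (r : Fin n → ℚ) (i : Fin n) (m m' : Mon n) :
    monVal r (mulVar i m) - monVal r (mulVar i m') = monVal r m - monVal r m' := by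
  simp only [mulVar, monVal_add]
  ring

end Monomials

/-! ### Coordinates of an arbitrary monomial in the staircase basis. -/

section Coord

variable {K : Type*} [Field K] [Valued K ℤᵐ⁰] {n : ℕ} {r : Fin n → ℚ}
  {I : Ideal (tateAlgebra K r)} {s : ℕ} {lm : Fin s → Mon n}

open Classical in
/-- The coordinate of `X ^ M` on the basis monomial `X ^ μ`. -/
def coord (b : Module.Basis (staircase lm) K (tateAlgebra K r ⧸ I)) (M μ : Mon n) : K :=
  if h : μ ∈ staircase lm then b.repr (quotMon I M) ⟨μ, h⟩ else 0

variable {b : Module.Basis (staircase lm) K (tateAlgebra K r ⧸ I)}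

theorem coord_coe (M : Mon n) (μ : staircase lm) :
    coord b M μ = b.repr (quotMon I M) μ := by
  rw [coord, dif_pos μ.2]

theorem coord_eq_basis_coord (M : Mon n) {μ : Mon n} (h : μ ∈ staircase lm) :
    coord b M μ = b.coord ⟨μ, h⟩ (quotMon I M) := by
  rw [coord, dif_pos h, Module.Basis.coord_apply]

variable (hb : ∀ m, b m = quotMon I m.1)

include hb

open Classical in
theorem coord_staircase {M μ : Mon n} (hM : M ∈ staircase lm) (hμ : μ ∈ staircase lm) :
    coord b M μ = if μ = M then 1 else 0 := by
  rw [coord, dif_pos hμ, ← hb ⟨M, hM⟩, Module.Basis.repr_self, Finsupp.single_apply]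
  simp only [Subtype.mk.injEq, eq_comm]

theorem quotMon_eq_sum (hB : (staircase lm).Finite) (M : Mon n) :
    quotMon I M = ∑ t ∈ hB.toFinset, coord b M t • quotMon I t := by
  have := hB.fintype
  rw [← b.sum_repr (quotMon I M), Finset.sum_subtype hB.toFinset (p := (· ∈ staircase lm))
    (fun x => hB.mem_toFinset)]
  exact Finset.sum_congr rfl fun x _ => by rw [coord_coe, hb]

theorem coord_unique (hB : (staircase lm).Finite) {M : Mon n} {c : Mon n → K}
    (h : quotMon I M = ∑ t ∈ hB.toFinset, c t • quotMon I t) {μ : Mon n} (hμ : μ ∈ staircase lm) :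
    coord b M μ = c μ := by
  classical
  rw [coord_eq_basis_coord _ hμ, h, map_sum, Finset.sum_eq_single μ]
  · rw [map_smul, ← hb ⟨μ, hμ⟩]
    simp
  · intro t ht htμ
    rw [hB.mem_toFinset] at ht
    rw [map_smul, ← hb ⟨t, ht⟩]
    simp [htμ]
  · intro h'
    exact absurd (hB.mem_toFinset.2 hμ) h'

/-- Multiply the normal form of `M` by `X_j`, using linearity. With `M = X_i m'` this is the sum
computed by the recursive branch. -/
theorem coord_mulVar (hB : (staircase lm).Finite) (j : Fin n) (M : Mon n) {μ : Mon n}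
    (hμ : μ ∈ staircase lm) :
    coord b (mulVar j M) μ = ∑ t ∈ hB.toFinset, coord b (mulVar j t) μ * coord b M t := by
  have hmul : ∀ u, quotMon I (mulVar j u) = quotMon I (Finsupp.single j 1) * quotMon I u :=
    fun u => by rw [quotMon_mul, add_comm, mulVar]
  rw [coord_eq_basis_coord _ hμ, hmul, quotMon_eq_sum hb hB M, Finset.mul_sum, map_sum]
  refine Finset.sum_congr rfl fun t _ => ?_
  rw [mul_smul_comm, ← hmul, map_smul, smul_eq_mul, ← coord_eq_basis_coord, mul_comm]

end Coord

/-! ### Arithmetic of the precisions: forced zero digits and full working precision. -/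

section Precision

variable {K : Type*} {n : ℕ}

theorem Input.v_le_low (A : Input.{w} K n) (M μ : Mon n) : A.v M μ ≤ A.low M μ := by
  unfold Input.low
  split_ifs
  · push_cast
    exact (Int.lt_floor_add_one _).le
  · exact Int.le_ceil _

theorem Input.v_lt_low (A : Input.{w} K n) {M μ : Mon n} (h : A.o.toSyn M < A.o.toSyn μ) :
    A.v M μ < A.low M μ := by
  unfold Input.low
  rw [if_pos h]
  push_cast
  exact Int.lt_floor_add_one _

theorem Input.full_le_low (A : Input.{w} K n) (M μ : Mon n) : A.full M μ ≤ A.low M μ + A.prec := by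
  have h : ⌊A.v M μ⌋ ≤ A.low M μ := by
    exact_mod_cast (Int.floor_le _).trans (A.v_le_low M μ)
  unfold Input.full
  linarith

theorem Input.le_full_iff (A : Input.{w} K n) {M μ : Mon n} {k : ℤ} :
    k ≤ A.full M μ ↔ (k : ℚ) ≤ A.prec + A.v M μ := by
  unfold Input.full
  rw [← sub_le_iff_le_add', Int.le_floor, ← sub_le_iff_le_add']
  push_cast
  rfl

/-- The intermediate monomial `μ'` cancels. All the bookkeeping of recursive precisions rests on
this identity. -/
theorem Input.v_add (A : Input.{w} K n) (j : Fin n) (M μ' μ : Mon n) :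
    A.v (mulVar j M) μ = A.v (mulVar j μ') μ + A.v M μ' := by
  have := monVal_mulVar_sub A.r j M μ'
  unfold Input.v
  linarith

/-- Together with `Input.full_right`, this keeps recursive requests within full working precision,
so that no entry ever gains more than `prec` digits. -/
theorem Input.full_left (A : Input.{w} K n) {j : Fin n} {M μ' μ : Mon n} {k l : ℤ}
    (hk : k ≤ A.full (mulVar j M) μ) (hl : A.low M μ' ≤ l) :
    k - l ≤ A.full (mulVar j μ') μ := by
  rw [A.le_full_iff] at *
  have h1 := A.v_add j M μ' μ
  have h2 := A.v_le_low M μ'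
  have h3 : (A.low M μ' : ℚ) ≤ l := by exact_mod_cast hl
  push_cast
  linarith

theorem Input.full_right (A : Input.{w} K n) {j : Fin n} {M μ' μ : Mon n} {k l : ℤ}
    (hk : k ≤ A.full (mulVar j M) μ) (hl : A.low (mulVar j μ') μ ≤ l) :
    k - l ≤ A.full M μ' := by
  rw [A.le_full_iff] at *
  have h1 := A.v_add j M μ' μ
  have h2 := A.v_le_low (mulVar j μ') μ
  have h3 : (A.low (mulVar j μ') μ : ℚ) ≤ l := by exact_mod_cast hl
  push_cast
  linarith

open Classical in
theorem State.set_table {S : Type*} (σ : State K n S) (p q : S) (μ ν : Mon n) (a : Approx K) :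
    (σ.set p μ a).table q ν = if q = p ∧ ν = μ then a else σ.table q ν := rfl

end Precision

/-! ### Lower bounds for the coordinates, and the entries read off from the Gröbner basis. -/

section Low

variable {K : Type*} [Field K] [Valued K ℤᵐ⁰] {n : ℕ} {A : Input.{w} K n}
  {I : Ideal (tateAlgebra K A.r)} {g : Fin A.s → tateAlgebra K A.r}
  {b : Module.Basis (staircase A.lm) K (tateAlgebra K A.r ⧸ I)}

variable (hG : IsReducedGB A.o I g A.lm) (hB : (staircase A.lm).Finite)
  (hb : ∀ m, b m = quotMon I m.1)

include hG hB hb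

/-- The term order bounds the coordinates of a monomial from below. -/
theorem IsReducedGB.valGE_low_coord {M μ : Mon n} (hμ : μ ∈ staircase A.lm) :
    ValGE (A.low M μ) (coord b M μ) := by
  classical
  by_cases hM : M ∈ staircase A.lm
  · rw [coord_staircase hb hM hμ]
    split_ifs with h
    · subst h
      right
      simp [Input.low, Input.v, valK_one]
    · exact ValGE.zero _
  by_cases hc : coord b M μ = 0
  · exact Or.inl hc
  set f : tateAlgebra K A.r := tateMon K A.r M - ∑ t ∈ hB.toFinset, coord b M t • tateMon K A.r t
    with hf
  have hcoef : ∀ u, tateCoeff f u =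
      (if u = M then 1 else 0) - if u ∈ hB.toFinset then coord b M u else 0 := fun u => by
    rw [hf, tateCoeff_sub, tateCoeff_tateMon, tateCoeff_sum_terms]
  have hM' : M ∉ hB.toFinset := by rwa [hB.mem_toFinset]
  have hμM : μ ≠ M := fun h => hM (h ▸ hμ)
  have hfM : tateCoeff f M = 1 := by rw [hcoef, if_pos rfl, if_neg hM', sub_zero]
  have hfμ : tateCoeff f μ = -coord b M μ := by
    rw [hcoef, if_neg hμM, if_pos (hB.mem_toFinset.2 hμ), zero_sub]
  have hf0 : f ≠ 0 := by
    intro h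
    rw [h, tateCoeff_zero] at hfM
    exact zero_ne_one hfM
  have hfI : f ∈ I := by
    rw [← Ideal.Quotient.eq_zero_iff_mem, hf, map_sub, map_sum, sub_eq_zero]
    exact quotMon_eq_sum hb hB M
  obtain ⟨u, hu, hlead⟩ := exists_isLeadingMon A.o (f := f) (t := insert M hB.toFinset) (by
    intro u hu
    by_contra h
    rw [Finset.mem_insert, not_or] at h
    rw [hcoef, if_neg h.1, if_neg h.2, sub_zero] at hu
    exact hu rfl) hf0
  -- The leading monomial is divisible by some `lm k`, which excludes all monomials of `f` except
  -- `M`.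
  have huM : u = M := by
    obtain ⟨k, hk⟩ := hG.groebner f hfI u hlead
    rcases Finset.mem_insert.1 hu with h | h
    · exact h
    · exact absurd hk (hB.mem_toFinset.1 h k)
  subst huM
  have hlt := hlead.2 μ hμM (by rw [hfμ]; exact neg_ne_zero.2 hc)
  have hneg : valK (-coord b u μ) = valK (coord b u μ) := by simp [valK]
  rw [hfM, hfμ, TermLT, valK_one, hneg] at hlt
  right
  push_cast at hlt
  unfold Input.low Input.v
  split_ifs with ho
  · rcases hlt with h | ⟨-, h⟩
    · rw [Int.add_one_le_iff, Int.floor_lt]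
      linarith
    · exact absurd h ho.not_gt
  · rw [Int.ceil_le]
    rcases hlt with h | ⟨h, -⟩ <;> linarith

/-- Since the basis is reduced, all non-leading terms of `g l` lie in the staircase, so `g l = 0` in
the quotient is already the normal form of `lm l`. -/
theorem IsReducedGB.coord_lm (l : Fin A.s) {μ : Mon n} (hμ : μ ∈ staircase A.lm) :
    coord b (A.lm l) μ = -(tateCoeff (g l) μ * (tateCoeff (g l) (A.lm l))⁻¹) := by
  refine coord_unique hb hB
    (c := fun t => -(tateCoeff (g l) t * (tateCoeff (g l) (A.lm l))⁻¹)) ?_ hμ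
  have hlc : tateCoeff (g l) (A.lm l) ≠ 0 := (hG.leading l).1
  have h := Ideal.Quotient.eq_zero_iff_mem.2 (hG.mem l)
  rw [hG.expand hB l, map_add, map_sum] at h
  simp only [mk_smul] at h
  have h2 := eq_neg_of_add_eq_zero_left h
  have h3 := congrArg (fun z => (tateCoeff (g l) (A.lm l))⁻¹ • z) h2
  simp only [smul_smul, inv_mul_cancel₀ hlc, one_smul] at h3
  rw [quotMon, h3, ← Finset.sum_neg_distrib, Finset.smul_sum]
  refine Finset.sum_congr rfl fun t _ => ?_
  rw [smul_neg, smul_smul, neg_smul, mul_comm, quotMon]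

/-- The entries read off from the approximations of the Gröbner basis. -/
theorem IsReducedGB.direct_entry {unif : K} (hu : Valued.v unif = WithZero.exp (-1 : ℤ))
    (hint : ∀ k u, GaussGE A.r 0 u (tateCoeff (g k) u))
    (hnorm : ∀ k, (valK (tateCoeff (g k) (A.lm k)) : ℚ) + monVal A.r (A.lm k) < 1)
    (hco : ∀ k u, GaussGE A.r A.prec u (A.coeff k u - tateCoeff (g k) u))
    (l : Fin A.s) {μ : Mon n} (hμ : μ ∈ staircase A.lm)
    (hlow : A.low (A.lm l) μ < A.full (A.lm l) μ) {x y : K}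
    (hx : x = unif ^ (-(A.low (A.lm l) μ + ⌈-monVal A.r (A.lm l)⌉)) * A.coeff l μ)
    (hy : y = unif ^ ⌈-monVal A.r (A.lm l)⌉ * (A.coeff l (A.lm l))⁻¹) :
    ValGE 0 x ∧ ValGE 0 y ∧
      ValGE (A.full (A.lm l) μ) (-(unif ^ A.low (A.lm l) μ * (x * y)) - coord b (A.lm l) μ) := by
  set M := A.lm l with hM
  set e := ⌈-monVal A.r M⌉ with he
  set ℓ := A.low M μ with hℓ
  set a := tateCoeff (g l) M with ha
  set c := A.coeff l M with hc
  set d := A.coeff l μ with hd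
  set p := tateCoeff (g l) μ with hp
  have hpc : coord b M μ = -(p * a⁻¹) := hG.coord_lm hB hb l hμ
  have ha0 : a ≠ 0 := (hG.leading l).1
  have hu0 := unif_ne_zero hu
  -- Integrality and the normalization confine `valK a` to an interval of length 1, so the leading
  -- monomial alone determines it.
  have hea : valK a = e := by
    have h1 := (hint l M).resolve_left ha0
    have h2 := hnorm l
    rw [← hM, ← ha] at h2
    rw [he, eq_comm, Int.ceil_eq_iff]
    constructor <;> linarith
  have hv : (A.v M μ : ℚ) = monVal A.r M - monVal A.r μ := rfl
  -- The entry is computed only when more than the forced digits is wanted, so `prec` is positive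
  -- and the approximate leading coefficient has the exact valuation.
  have hprec : (1 : ℤ) ≤ A.prec := by
    have := A.full_le_low M μ
    linarith
  have hca : ValGE (A.prec + e) (c - a) := by
    have := hco l M
    rw [gaussGE_iff, sub_eq_add_neg, Int.ceil_natCast_add] at this
    exact this
  obtain ⟨hc0, hec⟩ := valK_eq_of_sub (y := c) ha0 (hca.mono (by linarith))
  rw [hea] at hec
  have hcinv : ValGE (-e) c⁻¹ := ValGE.inv_of_le hec.le
  have hainv : ValGE (-e) a⁻¹ := ValGE.inv_of_le hea.le
  have hdp : ValGE (A.prec + ⌈-monVal A.r μ⌉) (d - p) := by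
    have := hco l μ
    rw [gaussGE_iff, sub_eq_add_neg, Int.ceil_natCast_add] at this
    exact this
  have hpv : ValGE ⌈-monVal A.r μ⌉ p := by
    have := hint l μ
    rw [gaussGE_iff, zero_sub] at this
    exact this
  have hfl : ⌊A.v M μ⌋ + e ≤ ⌈-monVal A.r μ⌉ := by
    have h1 := Int.floor_le (A.v M μ)
    have h2 := Int.ceil_lt_add_one (-monVal A.r M)
    have h3 := Int.le_ceil (-monVal A.r μ)
    rw [← he] at h2
    have : ((⌊A.v M μ⌋ + e : ℤ) : ℚ) < ⌈-monVal A.r μ⌉ + 1 := by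
      push_cast
      linarith
    exact Int.lt_add_one_iff.1 (by exact_mod_cast this)
  have hfull : A.full M μ = A.prec + ⌊A.v M μ⌋ := rfl
  have hp2 : ValGE (ℓ + e) p := by
    have h1 := (hG.valGE_low_coord hB hb (M := M) hμ).mul (valGE_valK a)
    rw [hpc, hea, neg_mul, inv_mul_cancel_right₀ ha0] at h1
    simpa using h1.neg
  have hd2 : ValGE (ℓ + e) d := by
    have h1 := (hdp.mono (by linarith : ℓ + e ≤ _)).add hp2
    rwa [sub_add_cancel] at h1
  refine ⟨?_, ?_, ?_⟩
  · rw [hx]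
    have := (valGE_unif_zpow hu (-(ℓ + e))).mul hd2
    rwa [neg_add_cancel] at this
  · rw [hy]
    have := (valGE_unif_zpow hu e).mul hcinv
    rwa [add_neg_cancel] at this
  · have h1 : unif ^ ℓ * (x * y) = d * c⁻¹ := by
      rw [hx, hy, neg_add, zpow_add₀ hu0, zpow_neg, zpow_neg]
      have := zpow_ne_zero ℓ hu0
      have := zpow_ne_zero e hu0
      field_simp
    have h2 : -(d * c⁻¹) - -(p * a⁻¹) = p * ((c - a) * (a⁻¹ * c⁻¹)) - (d - p) * c⁻¹ := by
      field_simp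
      ring
    rw [h1, hpc, h2]
    refine ((hpv.mul (hca.mul (hainv.mul hcinv))).mono ?_).sub ((hdp.mul hcinv).mono ?_) <;>
    · rw [hfull]
      linarith

end Low

/-! ### The recursive algorithm -/

section Algorithm

variable {K : Type*} [Field K] [Valued K ℤᵐ⁰] {n : ℕ} {S : Type*}

/-- Known digits of an approximation determine a lower bound of the valuation. -/
theorem Approx.knownVal_le_prec (a : Approx K) : a.knownVal ≤ a.prec := by
  unfold Approx.knownVal
  split_ifs with h
  · exact le_rfl
  · rw [ValGE, not_or, not_le] at h
    exact h.2.le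

/-- If the known digits vanish, so do those of `x`; otherwise the first nonzero digit gives the
exact valuation of `x`. The first conclusion serves termination, the second the error estimate of
products. -/
theorem Approx.knownVal_spec {a : Approx K} {x : K} (h : ValGE a.prec (a.val - x)) {l : ℤ}
    (hl : l ≤ a.prec) (hx : ValGE l x) : l ≤ a.knownVal ∧ ValGE a.knownVal x := by
  unfold Approx.knownVal
  split_ifs with h0
  · refine ⟨hl, ?_⟩
    have := h0.sub h
    rwa [sub_sub_cancel] at this
  · rw [ValGE, not_or, not_le] at h0
    have h1 : ValGE (valK a.val + 1) (x - a.val) := by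
      have := h.neg
      rw [neg_sub] at this
      exact this.mono h0.2
    obtain ⟨hx0, hv⟩ := valK_eq_of_sub h0.1 h1
    rw [← hv]
    exact ⟨hx.le_valK hx0, valGE_valK x⟩

/-- What the correctness proof uses about the coordinates `N` and about the rank `rk`, which
decreases in the recursive calls. -/
structure Spec (A : Input.{w} K n) (ch : Choices K n) (N : Mon n → Mon n → K)
    (rk : ℤ → Mon n → Mon n → ℤ) : Prop where
  unif_v : Valued.v A.unif = WithZero.exp (-1 : ℤ)
  down : ∀ j, ∀ m ∈ ch.stair, divVar j m ∈ ch.stair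
  round : ∀ k x, ValGE k (ch.round k x - x)
  coord_one : ∀ M ∈ ch.stair, N M M = 1
  coord_zero : ∀ M ∈ ch.stair, ∀ μ ∈ ch.stair, μ ≠ M → N M μ = 0
  low : ∀ M, ∀ μ ∈ ch.stair, ValGE (A.low M μ) (N M μ)
  direct : ∀ l, ∀ μ ∈ ch.stair, A.low (A.lm l) μ < A.full (A.lm l) μ → ∀ x y : K,
    x = A.unif ^ (-(A.low (A.lm l) μ + ⌈-monVal A.r (A.lm l)⌉)) * A.coeff l μ →
    y = A.unif ^ ⌈-monVal A.r (A.lm l)⌉ * (A.coeff l (A.lm l))⁻¹ →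
    ValGE 0 x ∧ ValGE 0 y ∧
      ValGE (A.full (A.lm l) μ) (-(A.unif ^ A.low (A.lm l) μ * (x * y)) - N (A.lm l) μ)
  factor : ∀ i, ∀ m ∈ ch.stair, mulVar i m ∉ ch.stair → (∀ l, A.lm l ≠ mulVar i m) →
    IsFactor ch.stair i m (ch.factor i m)
  coord_mulVar : ∀ j M, ∀ μ ∈ ch.stair,
    N (mulVar j M) μ = (ch.stair.map fun t => N (mulVar j t) μ * N M t).sum
  rk_mono : ∀ M μ, StrictMono fun k => rk k M μ
  rk_pos : ∀ i m μ k, m ∈ ch.stair → A.low (mulVar i m) μ < k → 0 < rk k (mulVar i m) μ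
  rk_left : ∀ i j m' μ μ' k l, m' ∈ ch.stair → μ' ∈ ch.stair → mulVar i m' ∉ ch.stair →
    A.low (mulVar i m') μ' ≤ l → rk (k - l) (mulVar j μ') μ < rk k (mulVar j (mulVar i m')) μ
  rk_right : ∀ i j m' μ μ' k l, m' ∈ ch.stair → μ' ∈ ch.stair →
    A.low (mulVar j μ') μ ≤ l → rk (k - l) (mulVar i m') μ' < rk k (mulVar j (mulVar i m')) μ

/-- The table holds correct approximations, each at least as precise as its initial value and at
most `prec` digits longer; all multiplications so far took place in the valuation ring. -/
structure Good (A : Input.{w} K n) (ch : Choices K n) (mon : S → Mon n) (N : Mon n → Mon n → K)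
    (σ : State K n S) : Prop where
  low_le : ∀ p, ∀ μ ∈ ch.stair, A.low (mon p) μ ≤ (σ.table p μ).prec
  le_low : ∀ p, ∀ μ ∈ ch.stair, (σ.table p μ).prec ≤ A.low (mon p) μ + A.prec
  approx : ∀ p, ∀ μ ∈ ch.stair, ValGE (σ.table p μ).prec ((σ.table p μ).val - N (mon p) μ)
  mults : ∀ q ∈ σ.mults, ValGE 0 q.1 ∧ ValGE 0 q.2

open Classical in
/-- The total precision of the slots in `E`. -/
def totalPrec (ch : Choices K n) (E : Finset S) (σ : State K n S) : ℤ :=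
  ∑ p ∈ E, ∑ μ ∈ ch.stair.toFinset, (σ.table p μ).prec

/-- The relation between the states before and after a part of a computation. -/
structure Step (A : Input.{w} K n) (ch : Choices K n) (mon : S → Mon n) (N : Mon n → Mon n → K)
    (rk : ℤ → Mon n → Mon n → ℤ) (E : Finset S) (R c : ℤ) (σ σ' : State K n S) : Prop where
  good : Good A ch mon N σ'
  mono : ∀ p, ∀ μ ∈ ch.stair, (σ.table p μ).prec ≤ (σ'.table p μ).prec
  -- Limited to entries computed by a loop: staircase and direct entries are written at full
  -- precision whatever `k` is requested, so their rank may exceed `R`.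
  bound : ∀ p, ∀ μ ∈ ch.stair, mon p ∉ ch.stair → (∀ l, A.lm l ≠ mon p) →
    (σ'.table p μ).prec ≤ (σ.table p μ).prec ∨ rk (σ'.table p μ).prec (mon p) μ ≤ R
  -- Multiplications are paid for by `δ` times the gain in total precision, up to the debt `c`; a
  -- negative `c` is a credit.
  cost : (σ'.mults.length : ℤ) + ch.stair.length * totalPrec ch E σ ≤
    σ.mults.length + ch.stair.length * totalPrec ch E σ' + c

variable {A : Input.{w} K n} {ch : Choices K n} {slot : Fin n → Mon n → S} {mon : S → Mon n}
  {N : Mon n → Mon n → K} {rk : ℤ → Mon n → Mon n → ℤ} {E : Finset S}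

theorem Step.refl {σ : State K n S} (h : Good A ch mon N σ) (R : ℤ) :
    Step A ch mon N rk E R 0 σ σ :=
  ⟨h, fun _ _ _ => le_rfl, fun _ _ _ _ _ => Or.inl le_rfl, by simp⟩

theorem Step.weaken {R R' c c' : ℤ} {σ σ' : State K n S} (h : Step A ch mon N rk E R c σ σ')
    (hR : R ≤ R') (hc : c ≤ c') : Step A ch mon N rk E R' c' σ σ' :=
  ⟨h.good, h.mono, fun p μ hμ h1 h2 => (h.bound p μ hμ h1 h2).imp id fun h => h.trans hR,
    h.cost.trans (by linarith)⟩

theorem Step.trans {R c c' : ℤ} {σ σ' σ'' : State K n S} (h : Step A ch mon N rk E R c σ σ')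
    (h' : Step A ch mon N rk E R c' σ' σ'') : Step A ch mon N rk E R (c + c') σ σ'' := by
  refine ⟨h'.good, fun p μ hμ => (h.mono p μ hμ).trans (h'.mono p μ hμ),
    fun p μ hμ h1 h2 => ?_, ?_⟩
  · rcases h'.bound p μ hμ h1 h2 with h3 | h3
    · rcases le_or_gt (σ'.table p μ).prec (σ.table p μ).prec with h4 | h4
      · exact Or.inl (h3.trans h4)
      -- The second part left this precision unchanged, so the bound from the first part applies.
      · rw [le_antisymm h3 (h'.mono p μ hμ)]
        exact h.bound p μ hμ h1 h2
    · exact Or.inr h3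
  · have := h.cost
    have := h'.cost
    linarith

theorem Step.log {σ : State K n S} (h : Good A ch mon N σ) (R : ℤ) {x y : K} (hx : ValGE 0 x)
    (hy : ValGE 0 y) : Step A ch mon N rk E R 1 σ (σ.log x y) := by
  refine ⟨⟨h.low_le, h.le_low, h.approx, fun q hq => ?_⟩, fun _ _ _ => le_rfl,
    fun _ _ _ _ _ => Or.inl le_rfl, ?_⟩
  · rcases List.mem_cons.1 hq with rfl | hq
    · exact ⟨hx, hy⟩
    · exact h.mults q hq
  · have h1 : totalPrec ch E (σ.log x y) = totalPrec ch E σ := rfl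
    have h2 : (σ.log x y).mults.length = σ.mults.length + 1 := rfl
    rw [h1, h2]
    push_cast
    linarith

theorem Step.set {σ : State K n S} (h : Good A ch mon N σ) {p : S} {μ : Mon n}
    (hμ : μ ∈ ch.stair) {a : Approx K} (hprec : (σ.table p μ).prec < a.prec)
    (hfull : a.prec ≤ A.full (mon p) μ) (happrox : ValGE a.prec (a.val - N (mon p) μ)) {R c : ℤ}
    (hR : mon p ∉ ch.stair → (∀ l, A.lm l ≠ mon p) → rk a.prec (mon p) μ ≤ R)
    (hc : c = 0 ∨ p ∈ E ∧ c = -ch.stair.length) :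
    Step A ch mon N rk E R c σ (σ.set p μ a) := by
  classical
  have hmono : ∀ q ν, (σ.table q ν).prec ≤ ((σ.set p μ a).table q ν).prec := by
    intro q ν
    rw [State.set_table]
    split_ifs with hq
    · rw [hq.1, hq.2]
      exact hprec.le
    · exact le_rfl
  refine ⟨⟨fun q ν hν => (h.low_le q ν hν).trans (hmono q ν), fun q ν hν => ?_, fun q ν hν => ?_,
    h.mults⟩, fun q ν _ => hmono q ν, fun q ν hν h1 h2 => ?_, ?_⟩
  · rw [State.set_table]
    split_ifs with hq
    · rw [hq.1, hq.2]
      exact hfull.trans (A.full_le_low _ _)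
    · exact h.le_low q ν hν
  · rw [State.set_table]
    split_ifs with hq
    · rw [hq.1, hq.2]
      exact happrox
    · exact h.approx q ν hν
  · rw [State.set_table]
    split_ifs with hq
    · obtain ⟨rfl, rfl⟩ := hq
      exact Or.inr (hR h1 h2)
    · exact Or.inl le_rfl
  · have hlen : (σ.set p μ a).mults = σ.mults := rfl
    have hpot : totalPrec ch E σ ≤ totalPrec ch E (σ.set p μ a) :=
      Finset.sum_le_sum fun q _ => Finset.sum_le_sum fun ν _ => hmono q ν
    have h0 : (0 : ℤ) ≤ ch.stair.length := Int.natCast_nonneg _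
    rw [hlen]
    rcases hc with rfl | ⟨hp, rfl⟩
    · have := mul_le_mul_of_nonneg_left hpot h0
      linarith
    · have hlt : totalPrec ch E σ < totalPrec ch E (σ.set p μ a) := by
        refine Finset.sum_lt_sum (fun q _ => Finset.sum_le_sum fun ν _ => hmono q ν)
          ⟨p, hp, Finset.sum_lt_sum (fun ν _ => hmono p ν) ⟨μ, List.mem_toFinset.2 hμ, ?_⟩⟩
        rwa [State.set_table, if_pos ⟨rfl, rfl⟩]
      have := mul_le_mul_of_nonneg_left (Int.add_one_le_of_lt hlt) h0
      linarith

theorem Spec.good_init (hs : Spec A ch N rk) : Good A ch mon N (initState A mon) :=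
  ⟨fun _ _ _ => le_rfl, fun p μ _ => by simp [initState], fun p μ hμ => by
    simpa [initState] using (hs.low (mon p) μ hμ).neg, fun q hq => by simp [initState] at hq⟩

/-- A loop over a list of basis monomials, accumulating a sum. -/
theorem foldlM_step {R k : ℤ} {f : State K n S × K → Mon n → Option (State K n S × K)}
    {F : Mon n → K} (l : List (Mon n))
    (hf : ∀ st, ∀ t ∈ l, Good A ch mon N st.1 → ∃ res, f st t = some res ∧
      Step A ch mon N rk E R 1 st.1 res.1 ∧ ValGE k (res.2 - st.2 - F t)) :
    ∀ st, Good A ch mon N st.1 → ∃ res, l.foldlM f st = some res ∧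
      Step A ch mon N rk E R l.length st.1 res.1 ∧ ValGE k (res.2 - st.2 - (l.map F).sum) := by
  induction l with
  | nil => exact fun st h => ⟨st, rfl, Step.refl h R, by left; simp⟩
  | cons t l ih =>
    intro st h
    obtain ⟨st', h1, h2, h3⟩ := hf st t List.mem_cons_self h
    obtain ⟨res, h4, h5, h6⟩ := ih (fun st u hu => hf st u (List.mem_cons_of_mem _ hu)) st' h2.good
    refine ⟨res, ?_, (h2.trans h5).weaken le_rfl ?_, ?_⟩
    · rw [List.foldlM_cons, h1]
      exact h4
    · rw [List.length_cons]
      push_cast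
      linarith
    · have := h3.add h6
      rw [List.map_cons, List.sum_cons]
      convert this using 1
      ring

/-- Induction on the fuel, which exceeds the rank. A loop incurs a debt of `δ` multiplications, and
writing its result repays it. The rank can be negative for a request already satisfied, hence the
separate positivity of `fuel`. -/
theorem Spec.mulMatRec_step (hs : Spec A ch N rk) (hmon : ∀ i m, mon (slot i m) = mulVar i m)
    (hE : ∀ i, ∀ m ∈ ch.stair, mulVar i m ∉ ch.stair → slot i m ∈ E) (fuel : ℕ) :
    ∀ (σ : State K n S) (i : Fin n) (μ m : Mon n) (k : ℤ), Good A ch mon N σ → μ ∈ ch.stair →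
      m ∈ ch.stair → k ≤ A.full (mulVar i m) μ → 0 < fuel → rk k (mulVar i m) μ < fuel →
      ∃ σ', mulMatRec A ch slot fuel σ i μ m k = some σ' ∧
        Step A ch mon N rk E (rk k (mulVar i m) μ) 0 σ σ' ∧
        k ≤ (σ'.table (slot i m) μ).prec := by
  induction fuel with
  | zero => intro σ i μ m k _ _ _ _ h; exact absurd h (lt_irrefl 0)
  | succ fuel ih =>
    intro σ i μ m k hσ hμ hm hk _ hrk
    rw [mulMatRec]
    dsimp only
    by_cases h1 : k ≤ (σ.table (slot i m) μ).prec
    · rw [if_pos h1]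
      exact ⟨σ, rfl, Step.refl hσ _, h1⟩
    rw [if_neg h1]
    rw [not_le] at h1
    have hlowk : A.low (mulVar i m) μ < k := by
      have := hσ.low_le (slot i m) μ hμ
      rw [hmon] at this
      exact this.trans_lt h1
    have hrkpos := hs.rk_pos i m μ k hm hlowk
    have hset : ∀ (τ : State K n S) (a : Approx K) (p : S),
        ((τ.set p μ a).table p μ).prec = a.prec := fun τ a p => by
      rw [State.set_table, if_pos ⟨rfl, rfl⟩]
    by_cases h2 : mulVar i m ∈ ch.stair
    · rw [if_pos h2]
      refine ⟨_, rfl, Step.set hσ hμ (h1.trans_le hk) (by rw [hmon]) ?_ ?_ (Or.inl rfl),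
        by rw [hset]; exact hk⟩
      · rw [hmon]
        left
        dsimp only
        split_ifs with h3
        · rw [h3, hs.coord_one _ h2, sub_self]
        · rw [hs.coord_zero _ h2 _ hμ h3, sub_self]
      · intro h3
        rw [hmon] at h3
        exact absurd h2 h3
    rw [if_neg h2]
    have hpE := hE i m hm h2
    split
    · rename_i l hl
      have hlM : A.lm l = mulVar i m := by simpa using List.find?_some hl
      obtain ⟨hx, hy, hxy⟩ := hs.direct l μ hμ (by rw [hlM]; exact hlowk.trans_le hk) _ _ rfl rfl
      simp only [hlM] at hx hy hxy
      refine ⟨_, rfl, ((Step.log hσ _ hx hy).trans (Step.set (c := -ch.stair.length)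
        (Step.log (rk := rk) (E := E) hσ 0 hx hy).good hμ (h1.trans_le hk) (by rw [hmon])
        (by rwa [hmon]) ?_
        (Or.inr ⟨hpE, rfl⟩))).weaken le_rfl ?_, by rw [hset]; exact hk⟩
      · intro _ h3
        rw [hmon] at h3
        exact absurd hlM (h3 l)
      -- One multiplication against a credit of `δ ≥ 1`.
      · have : 0 < ch.stair.length := List.length_pos_of_mem hm
        have : (1 : ℤ) ≤ ch.stair.length := by exact_mod_cast this
        linarith
    · rename_i hnone
      have hlm : ∀ l, A.lm l ≠ mulVar i m := by
        intro l
        have := List.find?_eq_none.1 hnone l (List.mem_finRange l)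
        simpa using this
      have hfac := hs.factor i m hm h2 hlm
      rw [if_pos hfac]
      set j := ch.factor i m with hj
      set m' := divVar j m with hm'
      have hm'B : m' ∈ ch.stair := hs.down j m hm
      have hMj : mulVar j (mulVar i m') = mulVar i m := mulVar_mulVar_divVar hfac.1
      -- A request that passes the first test has positive rank, so there is fuel left for the
      -- recursive calls.
      have hfuel : 0 < fuel := by
        by_contra h
        have h0 : fuel = 0 := by omega
        subst h0
        rw [zero_add, Nat.cast_one] at hrk
        linarith
      have hloop := foldlM_step (A := A) (ch := ch) (mon := mon) (N := N) (rk := rk) (E := E)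
        -- Everything done inside the loop has rank strictly below the current request.
        (R := rk k (mulVar i m) μ - 1) (k := k)
        (f := fun (st : State K n S × K) μ' =>
          (mulMatRec A ch slot fuel st.1 j μ μ'
            (k - (st.1.table (slot i m') μ').knownVal)).bind fun σ₁ =>
          (mulMatRec A ch slot fuel σ₁ i μ' m'
            (k - (st.1.table (slot j μ') μ).knownVal)).bind fun σ₂ =>
          some (σ₂.log (A.unif ^ (-A.low (mulVar j μ') μ) * (σ₂.table (slot j μ') μ).val)
              (A.unif ^ (-A.low (mulVar i m') μ') * (σ₂.table (slot i m') μ').val),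
            st.2 + A.unif ^ (A.low (mulVar j μ') μ + A.low (mulVar i m') μ') *
              (A.unif ^ (-A.low (mulVar j μ') μ) * (σ₂.table (slot j μ') μ).val *
                (A.unif ^ (-A.low (mulVar i m') μ') * (σ₂.table (slot i m') μ').val))))
        (F := fun t => N (mulVar j t) μ * N (mulVar i m') t) ch.stair ?_ (σ, 0) hσ
      · obtain ⟨res, hres, hstep, hval⟩ := hloop
        rw [hres]
        -- The rank increases strictly with the precision, so the loop cannot have brought the entry
        -- itself to precision `k`. The write below is therefore a strict gain.
        have hold : (res.1.table (slot i m) μ).prec < k := by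
          have h3 := hstep.bound (slot i m) μ hμ (by rwa [hmon]) (by rwa [hmon])
          rw [hmon] at h3
          rcases h3 with h3 | h3
          · exact h3.trans_lt h1
          · exact (hs.rk_mono (mulVar i m) μ).lt_iff_lt.1 (by linarith)
        refine ⟨_, rfl, ((hstep.weaken (by linarith) le_rfl).trans (Step.set
          (c := -ch.stair.length) hstep.good hμ hold (by rwa [hmon]) ?_ ?_
          (Or.inr ⟨hpE, rfl⟩))).weaken le_rfl (by linarith), by rw [hset]⟩
        · rw [hmon, ← hMj, hs.coord_mulVar _ _ _ hμ]
          dsimp only at hval ⊢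
          rw [sub_zero] at hval
          have := (hs.round k res.2).add hval
          rwa [sub_add_sub_cancel] at this
        · intro _ _
          rw [hmon]
      · intro st t ht hst
        have hks1 := Approx.knownVal_spec (hst.approx (slot i m') t ht)
          (hst.low_le (slot i m') t ht) (hs.low _ t ht)
        have hks2 := Approx.knownVal_spec (hst.approx (slot j t) μ hμ)
          (hst.low_le (slot j t) μ hμ) (hs.low _ μ hμ)
        have hkp1 := (st.1.table (slot i m') t).knownVal_le_prec
        have hkp2 := (st.1.table (slot j t) μ).knownVal_le_prec
        rw [hmon] at hks1 hks2
        set w := (st.1.table (slot i m') t).knownVal with hw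
        set v := (st.1.table (slot j t) μ).knownVal with hv
        have hr1 := hs.rk_left i j m' μ t k w hm'B ht hfac.2 hks1.1
        have hr2 := hs.rk_right i j m' μ t k v hm'B ht hks2.1
        rw [hMj] at hr1 hr2
        push_cast at hrk
        rw [← hMj] at hk
        obtain ⟨σ₁, e1, s1, p1⟩ := ih st.1 j μ t (k - w) hst hμ ht (A.full_left hk hks1.1) hfuel
          (by linarith)
        obtain ⟨σ₂, e2, s2, p2⟩ := ih σ₁ i t m' (k - v) s1.good ht hm'B (A.full_right hk hks2.1)
          hfuel (by linarith)
        have s12 := (s1.weaken (by linarith : _ ≤ rk k (mulVar i m) μ - 1) le_rfl).trans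
          (s2.weaken (by linarith : _ ≤ rk k (mulVar i m) μ - 1) le_rfl)
        have hg := s2.good
        have a1 := hg.approx (slot j t) μ hμ
        have a2 := hg.approx (slot i m') t ht
        have q1 := hg.low_le (slot j t) μ hμ
        have q2 := hg.low_le (slot i m') t ht
        have r2 := s12.mono (slot i m') t ht
        have r1 := s2.mono (slot j t) μ hμ
        rw [hmon] at a1 a2 q1 q2
        set c₁ := (σ₂.table (slot j t) μ).val with hc1
        set c₂ := (σ₂.table (slot i m') t).val with hc2
        have v1 : ValGE (A.low (mulVar j t) μ) c₁ := by
          have := (a1.mono q1).add (hs.low _ μ hμ)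
          rwa [sub_add_cancel] at this
        have v2 : ValGE (A.low (mulVar i m') t) c₂ := by
          have := (a2.mono q2).add (hs.low _ t ht)
          rwa [sub_add_cancel] at this
        have hx : ValGE 0 (A.unif ^ (-A.low (mulVar j t) μ) * c₁) := by
          have := (valGE_unif_zpow hs.unif_v (-A.low (mulVar j t) μ)).mul v1
          rwa [neg_add_cancel] at this
        have hy : ValGE 0 (A.unif ^ (-A.low (mulVar i m') t) * c₂) := by
          have := (valGE_unif_zpow hs.unif_v (-A.low (mulVar i m') t)).mul v2
          rwa [neg_add_cancel] at this
        refine ⟨_, by rw [e1, Option.bind_some, e2, Option.bind_some],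
          (s12.trans (Step.log hg _ hx hy)).weaken le_rfl (by norm_num : (0 + 0 + 1 : ℤ) ≤ 1), ?_⟩
        dsimp only
        rw [← hc1, ← hc2]
        have hprod : A.unif ^ (A.low (mulVar j t) μ + A.low (mulVar i m') t) *
            (A.unif ^ (-A.low (mulVar j t) μ) * c₁ *
              (A.unif ^ (-A.low (mulVar i m') t) * c₂)) = c₁ * c₂ := by
          have hu0 := unif_ne_zero hs.unif_v
          rw [zpow_add₀ hu0, zpow_neg, zpow_neg]
          have := zpow_ne_zero (A.low (mulVar j t) μ) hu0
          have := zpow_ne_zero (A.low (mulVar i m') t) hu0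
          field_simp
        rw [hprod]
        -- The valuations `v` and `w` were read before the calls. The error of the product is `(c₁ -
        -- N₁) c₂ + N₁ (c₂ - N₂)`, where `N₁`, `N₂` are the exact entries; it needs `w` for the
        -- refined `c₂` and `v` for the exact `N₁`.
        have hw2 : ValGE w c₂ := by
          have := (a2.mono (hkp1.trans r2)).add hks1.2
          rwa [sub_add_cancel] at this
        have t1 := (a1.mono (p1.trans r1)).mul hw2
        have t2 := hks2.2.mul (a2.mono p2)
        rw [sub_add_cancel] at t1
        rw [add_sub_cancel] at t2
        convert t1.add t2 using 1
        ring

theorem Spec.mulMat_step (hs : Spec A ch N rk) (hmon : ∀ i m, mon (slot i m) = mulVar i m)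
    (hE : ∀ i, ∀ m ∈ ch.stair, mulVar i m ∉ ch.stair → slot i m ∈ E) {fuel : ℕ} (h0 : 0 < fuel)
    (l : List (Fin n × Mon n × Mon n)) :
    (∀ t ∈ l, t.2.1 ∈ ch.stair ∧ t.2.2 ∈ ch.stair ∧
      rk (A.full (mulVar t.1 t.2.2) t.2.1) (mulVar t.1 t.2.2) t.2.1 < fuel) →
    ∀ σ, Good A ch mon N σ → ∃ R σ', (l.foldlM (init := σ) fun σ t =>
      mulMatRec A ch slot fuel σ t.1 t.2.1 t.2.2 (A.full (mulVar t.1 t.2.2) t.2.1)) = some σ' ∧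
      Step A ch mon N rk E R 0 σ σ' ∧
      ∀ t ∈ l, A.full (mulVar t.1 t.2.2) t.2.1 ≤ (σ'.table (slot t.1 t.2.2) t.2.1).prec := by
  induction l with
  | nil => exact fun _ σ h => ⟨0, σ, rfl, Step.refl h 0, by simp⟩
  | cons t l ih =>
    intro hl σ hσ
    obtain ⟨ht1, ht2, ht3⟩ := hl t List.mem_cons_self
    obtain ⟨σ₁, e1, s1, p1⟩ := hs.mulMatRec_step hmon hE fuel σ t.1 t.2.1 t.2.2 _ hσ ht1 ht2 le_rfl
      h0 ht3
    obtain ⟨R, σ₂, e2, s2, p2⟩ := ih (fun u hu => hl u (List.mem_cons_of_mem _ hu)) σ₁ s1.good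
    refine ⟨max (rk (A.full (mulVar t.1 t.2.2) t.2.1) (mulVar t.1 t.2.2) t.2.1) R, σ₂, ?_,
      (s1.weaken (le_max_left _ _) le_rfl).trans (s2.weaken (le_max_right _ _) le_rfl), ?_⟩
    · rw [List.foldlM_cons, e1]
      exact e2
    · intro u hu
      rcases List.mem_cons.1 hu with rfl | hu
      · exact p1.trans (s2.mono _ _ ht1)
      · exact p2 u hu

/-- Termination, correctness and cost of the algorithm. -/
theorem Spec.computes (hs : Spec A ch N rk) (hmon : ∀ i m, mon (slot i m) = mulVar i m)
    (hE : ∀ i, ∀ m ∈ ch.stair, mulVar i m ∉ ch.stair → slot i m ∈ E) {B : Set (Mon n)}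
    (hch : ch.Valid B) {T : Fin n → B → B → K} (hT : ∀ i μ m, T i μ m = N (mulVar i m) μ) :
    ComputesMulMat A ch slot mon B T (E.card * ch.stair.length ^ 2 * A.prec) := by
  classical
  obtain ⟨F, hF⟩ := (ch.calls.toFinset.image fun t =>
    rk (A.full (mulVar t.1 t.2.2) t.2.1) (mulVar t.1 t.2.2) t.2.1).bddAbove
  have hl : ∀ t ∈ ch.calls, t.2.1 ∈ ch.stair ∧ t.2.2 ∈ ch.stair ∧
      rk (A.full (mulVar t.1 t.2.2) t.2.1) (mulVar t.1 t.2.2) t.2.1 < (F.toNat + 1 : ℕ) := by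
    intro t ht
    have := (hch.mem_calls t).1 ht
    refine ⟨(hch.mem_stair _).2 this.1, (hch.mem_stair _).2 this.2, ?_⟩
    have h1 := hF (Finset.mem_coe.2 (Finset.mem_image_of_mem _ (List.mem_toFinset.2 ht)))
    have h2 := Int.self_le_toNat F
    push_cast
    linarith
  obtain ⟨R, σ, e, s, p⟩ := hs.mulMat_step (mon := mon) hmon hE F.toNat.succ_pos ch.calls hl _
    hs.good_init
  refine ⟨_, σ, e, fun i μ m => ?_, s.good.mults, ?_⟩
  · have hmem := p (i, μ.1, m.1) ((hch.mem_calls _).2 ⟨μ.2, m.2⟩)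
    refine ⟨hmem, ?_⟩
    have := s.good.approx (slot i m) μ ((hch.mem_stair _).2 μ.2)
    rw [hmon, ← hT] at this
    exact this.mono hmem
  · have hcost := s.cost
    -- Each of the `δ` entries in a column of `E` gains at most `prec` digits over its initial
    -- precision.
    have hpot : totalPrec ch E σ ≤
        totalPrec ch E (initState A mon) + E.card * (ch.stair.length * A.prec) := by
      have h1 : ∀ p ∈ E, ∑ μ ∈ ch.stair.toFinset, (σ.table p μ).prec ≤
          ∑ μ ∈ ch.stair.toFinset, ((initState A mon).table p μ).prec +
            ch.stair.length * A.prec := by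
        intro p _
        have h2 := Finset.sum_le_sum fun μ (hμ : μ ∈ ch.stair.toFinset) =>
          s.good.le_low p μ (List.mem_toFinset.1 hμ)
        rw [Finset.sum_add_distrib, Finset.sum_const, List.toFinset_card_of_nodup hch.nodup,
          nsmul_eq_mul] at h2
        exact h2
      have h3 := Finset.sum_le_sum h1
      rw [Finset.sum_add_distrib, Finset.sum_const, nsmul_eq_mul] at h3
      exact h3
    have h0 : (initState A mon).mults.length = 0 := rfl
    have h4 := mul_le_mul_of_nonneg_left hpot (Int.natCast_nonneg ch.stair.length)
    rw [h0] at hcost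
    zify
    push_cast at hcost
    nlinarith

end Algorithm

/-! ### The rank of a request -/

section Rank

variable {K : Type*} {n : ℕ}

/-- The monomials `X_i m` with `m` in the staircase. -/
def products {n : ℕ} (stair : Finset (Mon n)) : Finset (Mon n) :=
  open Classical in (Finset.univ ×ˢ stair).image fun p => mulVar p.1 p.2

theorem mulVar_mem_products {stair : Finset (Mon n)} (i : Fin n) {m : Mon n} (hm : m ∈ stair) :
    mulVar i m ∈ products stair := by
  classical
  exact Finset.mem_image.2 ⟨(i, m), Finset.mem_product.2 ⟨Finset.mem_univ _, hm⟩, rfl⟩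

/-- The number of elements of `F` that are smaller than `M` in the monomial order. -/
def orderIndex (o : MonomialOrder.{0, w} (Fin n)) (F : Finset (Mon n)) (M : Mon n) : ℕ :=
  open Classical in (F.filter fun u => o.toSyn u < o.toSyn M).card

theorem orderIndex_lt_card (o : MonomialOrder.{0, w} (Fin n)) {F : Finset (Mon n)} {M : Mon n}
    (hM : M ∈ F) : orderIndex o F M < F.card := by
  classical
  exact Finset.card_lt_card (Finset.filter_ssubset.2 ⟨M, hM, lt_irrefl _⟩)

theorem orderIndex_lt (o : MonomialOrder.{0, w} (Fin n)) {F : Finset (Mon n)} {M M' : Mon n}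
    (hM : M' ∈ F) (h : o.toSyn M' < o.toSyn M) : orderIndex o F M' < orderIndex o F M := by
  classical
  refine Finset.card_lt_card (Finset.ssubset_iff_of_subset ?_ |>.2 ⟨M', ?_, ?_⟩)
  · intro u hu
    rw [Finset.mem_filter] at *
    exact ⟨hu.1, hu.2.trans h⟩
  · exact Finset.mem_filter.2 ⟨hM, h⟩
  · simp

/-- A common denominator of the `r i`. -/
def Input.den (A : Input.{w} K n) : ℕ := ∏ i, (A.r i).den

theorem Input.den_pos (A : Input.{w} K n) : 0 < A.den := prod_den_pos A.r

/-- The integer `den * monVal u`. -/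
def Input.scaledVal (A : Input.{w} K n) (u : Mon n) : ℤ := (monVal_den_mul (r := A.r) u).choose

theorem Input.den_mul_monVal (A : Input.{w} K n) (u : Mon n) :
    (A.den : ℚ) * monVal A.r u = A.scaledVal u := (monVal_den_mul (r := A.r) u).choose_spec

/-- The rank of a request: requests are ordered by the relative precision `k - v`, then by the
monomial order. -/
def Input.rank (A : Input.{w} K n) (F : Finset (Mon n)) (k : ℤ) (M μ : Mon n) : ℤ :=
  (A.den * k - A.scaledVal M + A.scaledVal μ) * F.card + orderIndex A.o F M

theorem Input.scaled_eq (A : Input.{w} K n) (k : ℤ) (M μ : Mon n) :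
    ((A.den * k - A.scaledVal M + A.scaledVal μ : ℤ) : ℚ) = A.den * (k - A.v M μ) := by
  push_cast
  rw [← A.den_mul_monVal, ← A.den_mul_monVal, Input.v]
  ring

theorem Input.rank_lt (A : Input.{w} K n) {F : Finset (Mon n)} {k k' : ℤ} {M M' μ μ' : Mon n}
    (hM : M' ∈ F) (h : (k' : ℚ) - A.v M' μ' < k - A.v M μ ∨
      ((k' : ℚ) - A.v M' μ' = k - A.v M μ ∧ A.o.toSyn M' < A.o.toSyn M)) :
    A.rank F k' M' μ' < A.rank F k M μ := by
  have hD : (0 : ℚ) < A.den := by exact_mod_cast A.den_pos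
  have e1 := A.scaled_eq k M μ
  have e2 := A.scaled_eq k' M' μ'
  unfold Input.rank
  set x := A.den * k - A.scaledVal M + A.scaledVal μ
  set x' := A.den * k' - A.scaledVal M' + A.scaledVal μ'
  rcases h with h | ⟨h, h'⟩
  · have hx : x' < x := by
      have := mul_lt_mul_of_pos_left h hD
      rw [← e1, ← e2] at this
      exact_mod_cast this
    have h1 : (orderIndex A.o F M' : ℤ) < F.card := by exact_mod_cast orderIndex_lt_card A.o hM
    -- One unit of scaled relative precision outweighs any order index, as the latter is below
    -- `F.card` for members of `F`.
    have h2 : (x' + 1) * (F.card : ℤ) ≤ x * F.card :=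
      mul_le_mul_of_nonneg_right hx (Int.natCast_nonneg _)
    have h3 : (0 : ℤ) ≤ orderIndex A.o F M := Int.natCast_nonneg _
    linarith
  · have hx : x' = x := by
      rw [h, ← e1] at e2
      exact_mod_cast e2
    have h1 : (orderIndex A.o F M' : ℤ) < orderIndex A.o F M := by
      exact_mod_cast orderIndex_lt A.o hM h'
    rw [hx]
    linarith

theorem Input.rank_pos (A : Input.{w} K n) {F : Finset (Mon n)} {k : ℤ} {M μ : Mon n}
    (hM : M ∈ F) (h : A.low M μ < k) : 0 < A.rank F k M μ := by
  have hD : (0 : ℚ) < A.den := by exact_mod_cast A.den_pos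
  have h1 : A.v M μ < k := (A.v_le_low M μ).trans_lt (by exact_mod_cast h)
  have h2 := A.scaled_eq k M μ
  have h3 := mul_pos hD (sub_pos.2 h1)
  rw [← h2] at h3
  have h4 : 0 < A.den * k - A.scaledVal M + A.scaledVal μ := by exact_mod_cast h3
  have h5 : (0 : ℤ) < F.card := by exact_mod_cast Finset.card_pos.2 ⟨M, hM⟩
  have h6 := mul_pos h4 h5
  unfold Input.rank
  have h7 : (0 : ℤ) ≤ orderIndex A.o F M := Int.natCast_nonneg _
  linarith

theorem Input.rank_strictMono (A : Input.{w} K n) {F : Finset (Mon n)} (hF : F.Nonempty)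
    (M μ : Mon n) : StrictMono fun k => A.rank F k M μ := by
  intro k k' h
  have hD : (0 : ℤ) < A.den := by exact_mod_cast A.den_pos
  have hc : (0 : ℤ) < F.card := by exact_mod_cast hF.card_pos
  have := mul_lt_mul_of_pos_right (mul_lt_mul_of_pos_left h hD) hc
  simp only [Input.rank]
  linarith

/-- Equality of relative precisions forces `v` to equal the number of forced digits, which excludes
`M < μ'` in the monomial order. As `μ' ≠ M`, this leaves `μ' < M`, and multiplication by `X_j`
preserves it. -/
theorem Input.rank_left (A : Input.{w} K n) {F : Finset (Mon n)} {j : Fin n} {M μ μ' : Mon n}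
    {k l : ℤ} (hF : mulVar j μ' ∈ F) (hne : μ' ≠ M) (hl : A.low M μ' ≤ l) :
    A.rank F (k - l) (mulVar j μ') μ < A.rank F k (mulVar j M) μ := by
  refine A.rank_lt hF ?_
  have h1 := A.v_add j M μ' μ
  have h2 := A.v_le_low M μ'
  have h3 : (A.low M μ' : ℚ) ≤ l := by exact_mod_cast hl
  push_cast
  rcases (h2.trans h3).lt_or_eq with h4 | h4
  · left
    linarith
  · right
    refine ⟨by linarith, ?_⟩
    have h5 : ¬ A.o.toSyn M < A.o.toSyn μ' := fun h => by
      have := A.v_lt_low h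
      linarith
    rw [mulVar, mulVar, map_add, map_add]
    exact add_lt_add_left (lt_of_le_of_ne (not_lt.1 h5) fun h => hne (A.o.toSyn.injective h)) _

/-- In the case of equal relative precisions, `M` is smaller than `X_j M`. -/
theorem Input.rank_right (A : Input.{w} K n) {F : Finset (Mon n)} {j : Fin n} {M μ μ' : Mon n}
    {k l : ℤ} (hF : M ∈ F) (hl : A.low (mulVar j μ') μ ≤ l) :
    A.rank F (k - l) M μ' < A.rank F k (mulVar j M) μ := by
  refine A.rank_lt hF ?_
  have h1 := A.v_add j M μ' μ
  have h2 := A.v_le_low (mulVar j μ') μ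
  have h3 : (A.low (mulVar j μ') μ : ℚ) ≤ l := by exact_mod_cast hl
  push_cast
  rcases (h2.trans h3).lt_or_eq with h4 | h4
  · left
    linarith
  · right
    refine ⟨by linarith, ?_⟩
    rw [mulVar, map_add]
    refine lt_add_of_pos_right _ ?_
    rw [MonomialOrder.toSyn_lt_iff_ne_zero, Ne, MonomialOrder.toSyn_eq_zero_iff]
    simp

end Rank

/-! ### Cost of the computation of the multiplication matrices -/

section Main

variable {K : Type*} [Field K] [Valued K ℤᵐ⁰] {n : ℕ} {A : Input.{w} K n}
  {I : Ideal (tateAlgebra K A.r)} {g : Fin A.s → tateAlgebra K A.r}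
  {b : Module.Basis (staircase A.lm) K (tateAlgebra K A.r ⧸ I)} {ch : Choices K n}

theorem IsReducedGB.spec (hG : IsReducedGB A.o I g A.lm) (hB : (staircase A.lm).Finite)
    (hb : ∀ m, b m = quotMon I m.1) (hu : Valued.v A.unif = WithZero.exp (-1 : ℤ))
    (hint : ∀ k u, GaussGE A.r 0 u (tateCoeff (g k) u))
    (hnorm : ∀ k, (valK (tateCoeff (g k) (A.lm k)) : ℚ) + monVal A.r (A.lm k) < 1)
    (hco : ∀ k u, GaussGE A.r A.prec u (A.coeff k u - tateCoeff (g k) u))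
    (hch : ch.Valid (staircase A.lm)) :
    -- Inserting 0 only makes the index set nonempty, as strict monotonicity of the rank requires
    -- even when there are no products.
    Spec A ch (coord b) (A.rank (insert 0 (products hB.toFinset))) where
  unif_v := hu
  down j m hm := by
    rw [hch.mem_stair] at *
    exact staircase_mono (divVar_le j m) hm
  round := hch.round_spec
  coord_one M hM := by
    rw [hch.mem_stair] at hM
    rw [coord_staircase hb hM hM, if_pos rfl]
  coord_zero M hM μ hμ h := by
    rw [hch.mem_stair] at hM hμ
    rw [coord_staircase hb hM hμ, if_neg h]
  low M μ hμ := hG.valGE_low_coord hB hb ((hch.mem_stair μ).1 hμ)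
  direct l μ hμ hlow x y hx hy :=
    hG.direct_entry hB hb hu hint hnorm hco l ((hch.mem_stair μ).1 hμ) hlow hx hy
  factor i m hm hM hlm := by
    rw [hch.mem_stair] at hm hM
    obtain ⟨j, h1, h2⟩ := exists_factor hm hM hlm
    exact hch.factor_spec i m ⟨j, h1, by rwa [hch.mem_stair]⟩
  coord_mulVar j M μ hμ := by
    classical
    have : hB.toFinset = ch.stair.toFinset := by
      ext m
      rw [hB.mem_toFinset, List.mem_toFinset, hch.mem_stair]
    rw [coord_mulVar hb hB j M ((hch.mem_stair μ).1 hμ), this,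
      List.sum_toFinset _ hch.nodup]
  rk_mono M μ := A.rank_strictMono ⟨0, Finset.mem_insert_self _ _⟩ M μ
  rk_pos i m μ k hm h := A.rank_pos (Finset.mem_insert_of_mem (mulVar_mem_products i
    (hB.mem_toFinset.2 ((hch.mem_stair m).1 hm)))) h
  rk_left i j m' μ μ' k l _ hμ' hM hl := A.rank_left (Finset.mem_insert_of_mem
    (mulVar_mem_products j (hB.mem_toFinset.2 ((hch.mem_stair μ').1 hμ'))))
    (fun h => hM (h ▸ hμ')) hl
  rk_right i j m' μ μ' k l hm' _ hl := A.rank_right (Finset.mem_insert_of_mem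
    (mulVar_mem_products i (hB.mem_toFinset.2 ((hch.mem_stair m').1 hm')))) hl

theorem boundary_finite {s : ℕ} {lm : Fin s → Mon n} (hB : (staircase lm).Finite) :
    (boundary lm).Finite := by
  refine (products hB.toFinset).finite_toSet.subset ?_
  rintro M ⟨⟨i, m, hm, rfl⟩, -⟩
  exact mulVar_mem_products i (hB.mem_toFinset.2 hm)

theorem ComputesMulMat.mono {S : Type*} {slot : Fin n → Mon n → S} {mon : S → Mon n}
    {B : Set (Mon n)} {T : Fin n → B → B → K} {N N' : ℕ}
    (h : ComputesMulMat A ch slot mon B T N) (hN : N ≤ N') :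
    ComputesMulMat A ch slot mon B T N' := by
  obtain ⟨fuel, σ, h1, h2, h3, h4⟩ := h
  exact ⟨fuel, σ, h1, h2, h3, h4.trans hN⟩

end Main

end

end TateFGLM

theorem mainTheorem4 :
    ∃ C : ℕ, ∀ (K : Type*) [Field K] [Valued K ℤᵐ⁰] [CompleteSpace K]
      (unif : K) (_ : Valued.v unif = WithZero.exp (-1 : ℤ))
      (n : ℕ) (r : Fin n → ℚ) (o : MonomialOrder (Fin n))
      (J : Ideal (TateFGLM.integralTate K r)) (I : Ideal (TateFGLM.tateAlgebra K r))
      (_ : I = J.map (TateFGLM.integralTate K r).subtype)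
      (_ : Module.Finite K (TateFGLM.tateAlgebra K r ⧸ I))
      -- a reduced Gröbner basis with elements in the integral ideal, normalized
      (s : ℕ) (g : Fin s → TateFGLM.integralTate K r) (lm : Fin s → TateFGLM.Mon n)
      (_ : ∀ k, g k ∈ J)
      (_ : TateFGLM.IsReducedGB o I (fun k => (g k : TateFGLM.tateAlgebra K r)) lm)
      (_ : ∀ k, 0 ≤ (TateFGLM.valK (TateFGLM.tateCoeff (g k).1 (lm k)) : ℚ)
          + TateFGLM.monVal r (lm k) ∧
        (TateFGLM.valK (TateFGLM.tateCoeff (g k).1 (lm k)) : ℚ) + TateFGLM.monVal r (lm k) < 1)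
      -- its elements are known at precision `prec`
      (prec : ℕ) (coeff : Fin s → TateFGLM.Mon n → K)
      (_ : ∀ k u, TateFGLM.GaussGE r prec u (coeff k u - TateFGLM.tateCoeff (g k).1 u)),
      (TateFGLM.staircase lm).Finite ∧
      ∃ b : Module.Basis (TateFGLM.staircase lm) K (TateFGLM.tateAlgebra K r ⧸ I),
        (∀ m, b m = Ideal.Quotient.mk I (TateFGLM.tateMon K r m)) ∧
        ∀ (T : Fin n → TateFGLM.staircase lm → TateFGLM.staircase lm → K)
          -- the multiplication matrices
          (_ : ∀ i μ m, T i μ m =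
            b.repr (Ideal.Quotient.mk I (TateFGLM.tateMon K r (Finsupp.single i 1)) * b m) μ)
          (ch : TateFGLM.Choices K n) (_ : ch.Valid (TateFGLM.staircase lm))
          (A : TateFGLM.Input K n) (_ : A = ⟨r, o, unif, prec, s, lm, coeff⟩)
          (ε δ : ℕ) (_ : ε = (TateFGLM.boundary lm).ncard)
          (_ : δ = Module.finrank K (TateFGLM.tateAlgebra K r ⧸ I)),
          -- one column of the table for each monomial `X_i m`
          TateFGLM.ComputesMulMat A ch TateFGLM.mulVar id (TateFGLM.staircase lm) T
            (C * (ε * δ ^ 2 * prec)) ∧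
          -- one column of the table for each pair `(i, m)`
          TateFGLM.ComputesMulMat A ch Prod.mk (fun p => TateFGLM.mulVar p.1 p.2)
            (TateFGLM.staircase lm) T (C * (n * ε * δ ^ 2 * prec)) := by
  classical
  refine ⟨1, ?_⟩
  intro K _ _ _ unif hu n r o J I _ _ s g lm _ hG hnorm prec coeff hco
  have hB := hG.staircase_finite
  have hnorm' := fun k => (hnorm k).2
  refine ⟨hB, Module.Basis.mk hG.linearIndependent (hG.span_eq_top hB hnorm' hu),
    fun m => Module.Basis.mk_apply _ _ m, ?_⟩
  generalize hbdef : Module.Basis.mk hG.linearIndependent (hG.span_eq_top hB hnorm' hu) = b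
  have hb : ∀ m, b m = TateFGLM.quotMon I m.1 := fun m => by
    rw [← hbdef, Module.Basis.mk_apply]
  rintro T hT ch hch A rfl ε δ rfl rfl
  have hs := TateFGLM.IsReducedGB.spec (A := ⟨r, o, unif, prec, s, lm, coeff⟩) hG hB hb hu
    (fun k u => (g k).2 u) hnorm' hco hch
  have hT' : ∀ i μ m, T i μ m = TateFGLM.coord b (TateFGLM.mulVar i m) μ := fun i μ m => by
    rw [hT, hb, TateFGLM.coord_coe, TateFGLM.mulVar, add_comm, ← TateFGLM.quotMon_mul]
    rfl
  have hlen : ch.stair.length = Module.finrank K (TateFGLM.tateAlgebra K r ⧸ I) := by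
    have h1 : ch.stair.toFinset = hB.toFinset := by
      ext m
      rw [hB.mem_toFinset, List.mem_toFinset, hch.mem_stair]
    rw [Module.finrank_eq_nat_card_basis b, Nat.card_coe_set_eq, Set.ncard_eq_toFinset_card _ hB,
      ← h1, List.toFinset_card_of_nodup hch.nodup]
  have hbd := TateFGLM.boundary_finite hB
  have hmem : ∀ i, ∀ m ∈ ch.stair, TateFGLM.mulVar i m ∉ ch.stair →
      m ∈ TateFGLM.staircase lm ∧ TateFGLM.mulVar i m ∈ TateFGLM.boundary lm := by
    intro i m hm hM
    rw [hch.mem_stair] at hm hM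
    exact ⟨hm, ⟨i, m, hm, rfl⟩, hM⟩
  constructor
  · refine (hs.computes (slot := TateFGLM.mulVar) (mon := id) (E := hbd.toFinset)
      (fun _ _ => rfl) (fun i m hm hM => hbd.mem_toFinset.2 (hmem i m hm hM).2) hch hT').mono ?_
    rw [one_mul, hlen, Set.ncard_eq_toFinset_card _ hbd]
  · set E : Finset (Fin n × TateFGLM.Mon n) := (Finset.univ ×ˢ hB.toFinset).filter
      fun p => TateFGLM.mulVar p.1 p.2 ∈ TateFGLM.boundary lm with hE
    have hcard : E.card ≤ n * (TateFGLM.boundary lm).ncard := by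
      have h1 : E.card ≤ ((Finset.univ : Finset (Fin n)) ×ˢ hbd.toFinset).card := by
        -- For fixed `i` the map from `m` to `X_i m` is injective, so each variable contributes at
        -- most `ε` columns.
        refine Finset.card_le_card_of_injOn (fun p => (p.1, TateFGLM.mulVar p.1 p.2)) ?_ ?_
        · intro p hp
          have hp' := (Finset.mem_filter.1 hp).2
          exact Finset.mem_coe.2 (Finset.mem_product.2 ⟨Finset.mem_univ _,
            hbd.mem_toFinset.2 hp'⟩)
        · rintro ⟨i, m⟩ _ ⟨i', m'⟩ _ h
          obtain ⟨rfl, h2⟩ := Prod.mk.inj h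
          exact Prod.ext rfl (add_right_cancel h2)
      rwa [Finset.card_product, Finset.card_univ, Fintype.card_fin,
        ← Set.ncard_eq_toFinset_card _ hbd] at h1
    refine (hs.computes (slot := Prod.mk) (mon := fun p => TateFGLM.mulVar p.1 p.2) (E := E)
      (fun _ _ => rfl) (fun i m hm hM => ?_) hch hT').mono ?_
    · exact Finset.mem_filter.2 ⟨Finset.mem_product.2 ⟨Finset.mem_univ _,
        hB.mem_toFinset.2 (hmem i m hm hM).1⟩, (hmem i m hm hM).2⟩
    · rw [one_mul, hlen]
      exact Nat.mul_le_mul_right _ (Nat.mul_le_mul_right _ hcard)
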